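/- Let $\mathbb{K}\in\{\mathbb{R},\mathbb{C}\}$, let $\mathscr{S}(\mathbb{R})$ be the Schwartz space of rapidly decreasing $\mathbb{K}$-valued functions on $\mathbb{R}$, and let $\mathscr{O}_M(\mathbb{R})$ be the space of smooth functions $f:\mathbb{R}\to\mathbb{K}$ such that for every $j\ge 0$ there are $C,k\ge 0$ with $|f^{(j)}(x)|\le C(1+|x|)^k$ for all $x\in\mathbb{R}$. Equip $\mathscr{O}_M(\mathbb{R})$ with its natural locally convex topology, given by the seminorms $$p_{m,v}(f)=\sup_{x\in\mathbb{R}}\max_{0\le j\le m}|v(x)f^{(j)}(x)|,\qquad m\ge 0,\ v\in\mathscr{S}(\mathbb{R}).$$ An operator $T$ on a topological vector space $X$ is called mixing if for all non-empty open sets $U,V\subseteq X$ there is $N\in\mathbb{N}$ such that $T^n(U)\cap V\neq\emptyset$ for every $n\ge N$. For a bijection $\psi:\mathbb{R}\to\mathbb{R}$ and $n\in\mathbb{N}$ let $\psi_n$ be the $n$-fold iterate of $\psi$ and let $\psi_{-n}$ be the inverse function of $\psi_n$. **Theorem.** Let $\psi:\mathbb{R}\to\mathbb{R}$ be bijective with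 $\psi\in\mathscr{O}_M(\mathbb{R})$. The following conditions are equivalent. (i) The composition operator $C_\psi:\mathscr{O}_M(\mathbb{R})\to\mathscr{O}_M(\mathbb{R})$, $f\mapsto f\circ\psi$, is mixing, and for every $v\in\mathscr{S}(\mathbb{R})$ $$\lim_{n\to\infty}v(\psi_n(0))\cdot n=0\quad\text{and}\quad\lim_{n\to\infty}v(\psi_{-n}(0))\cdot n=0.$$ (ii) There is a real-valued function $H\in\mathscr{O}_M(\mathbb{R})$ with $H'(x)\neq 0$ for every $x\in\mathbb{R}$ and $$H(\psi(x))=H(x)+1\quad\text{for every }x\in\mathbb{R}.$$ -/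

import Mathlib

open Filter Topology
open scoped SchwartzMap ContDiff

noncomputable section

/-- The space `𝒪_M(ℝ)` of slowly increasing smooth `𝕜`-valued functions on `ℝ`, as a subspace of the
space of all functions: smooth functions all of whose derivatives are polynomially bounded. -/
def slowlyIncreasing (𝕜 : Type*) [RCLike 𝕜] : Submodule 𝕜 (ℝ → 𝕜) where
  carrier := {f | f.HasTemperateGrowth}
  add_mem' hf hg := Function.HasTemperateGrowth.add hf hg
  zero_mem' := Function.HasTemperateGrowth.zero
  smul_mem' c f hf := by
    have h : (fun x => c * f x).HasTemperateGrowth :=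
      (Function.HasTemperateGrowth.const c).mul hf
    exact h

/-- The type of elements of `𝒪_M(ℝ)`. It is a type of its own, so that it does not inherit
the topology of pointwise convergence. -/
def OM (𝕜 : Type*) [RCLike 𝕜] : Type _ := slowlyIncreasing 𝕜

namespace OM

variable {𝕜 : Type*} [RCLike 𝕜]

instance : AddCommGroup (OM 𝕜) := inferInstanceAs (AddCommGroup (slowlyIncreasing 𝕜))

instance : Module 𝕜 (OM 𝕜) := inferInstanceAs (Module 𝕜 (slowlyIncreasing 𝕜))

instance : FunLike (OM 𝕜) ℝ 𝕜 where
  coe f := Subtype.val (p := (· ∈ slowlyIncreasing 𝕜)) f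
  coe_injective := Subtype.val_injective

theorem hasTemperateGrowth (f : OM 𝕜) : Function.HasTemperateGrowth (f : ℝ → 𝕜) := f.2

theorem coe_add (f g : OM 𝕜) : ((f + g : OM 𝕜) : ℝ → 𝕜) = (f : ℝ → 𝕜) + g := rfl

theorem coe_smul (c : 𝕜) (f : OM 𝕜) : ((c • f : OM 𝕜) : ℝ → 𝕜) = c • (f : ℝ → 𝕜) := rfl

theorem contDiffAt (f : OM 𝕜) (j : ℕ) (x : ℝ) : ContDiffAt ℝ j (f : ℝ → 𝕜) x :=
  (f.hasTemperateGrowth.1.of_le (by exact_mod_cast le_top)).contDiffAt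

theorem bddAbove (j : ℕ) (v : 𝓢(ℝ, 𝕜)) (f : OM 𝕜) :
    BddAbove (Set.range fun x : ℝ => ‖v x * iteratedDeriv j f x‖) := by
  obtain ⟨k, C, hC⟩ := f.hasTemperateGrowth.2 j
  refine ⟨2 ^ k * (Finset.Iic (k, 0)).sup
    (fun m => SchwartzMap.seminorm 𝕜 m.1 m.2) v * |C|, ?_⟩
  rintro _ ⟨x, rfl⟩
  have h1 : (1 + ‖x‖) ^ k * ‖v x‖ ≤
      2 ^ k * (Finset.Iic (k, 0)).sup (fun m => SchwartzMap.seminorm 𝕜 m.1 m.2) v := by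
    simpa using SchwartzMap.one_add_le_sup_seminorm_apply (𝕜 := 𝕜) (m := (k, 0))
      le_rfl le_rfl v x
  have h2 : ‖iteratedDeriv j f x‖ ≤ |C| * (1 + ‖x‖) ^ k := by
    rw [← norm_iteratedFDeriv_eq_norm_iteratedDeriv]
    exact (hC x).trans (by gcongr; exact le_abs_self C)
  calc ‖v x * iteratedDeriv j f x‖ = ‖v x‖ * ‖iteratedDeriv j f x‖ := norm_mul _ _
    _ ≤ ‖v x‖ * (|C| * (1 + ‖x‖) ^ k) := by gcongr
    _ = ((1 + ‖x‖) ^ k * ‖v x‖) * |C| := by ring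
    _ ≤ _ := by gcongr

/-- The seminorm `f ↦ sup_x |v(x) f⁽ʲ⁾(x)|`, for a Schwartz function `v`. -/
def derivSeminorm (j : ℕ) (v : 𝓢(ℝ, 𝕜)) : Seminorm 𝕜 (OM 𝕜) :=
  Seminorm.of (fun f => ⨆ x : ℝ, ‖v x * iteratedDeriv j f x‖)
    (fun f g => by
      refine ciSup_le fun x => ?_
      rw [coe_add, iteratedDeriv_add (f.contDiffAt j x) (g.contDiffAt j x), mul_add]
      exact (norm_add_le _ _).trans
        (add_le_add (le_ciSup (bddAbove j v f) x) (le_ciSup (bddAbove j v g) x)))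
    (fun c f => by
      rw [Real.mul_iSup_of_nonneg (norm_nonneg c)]
      refine iSup_congr fun x => ?_
      rw [coe_smul, iteratedDeriv_const_smul_field, smul_eq_mul, ← norm_mul]
      congr 1
      ring)

/-- The fundamental system `p_{m,v}(f) = sup_x max_{0 ≤ j ≤ m} |v(x) f⁽ʲ⁾(x)|`, where `m ≥ 0` and
`v` is a Schwartz function. -/
def seminormFamily (𝕜 : Type*) [RCLike 𝕜] : SeminormFamily 𝕜 (OM 𝕜) (ℕ × 𝓢(ℝ, 𝕜)) :=
  fun p => (Finset.range (p.1 + 1)).sup fun j => derivSeminorm j p.2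

/-- The natural locally convex topology of `𝒪_M(ℝ)`. -/
instance : TopologicalSpace (OM 𝕜) := (seminormFamily 𝕜).moduleFilterBasis.topology

theorem withSeminorms : WithSeminorms (seminormFamily 𝕜) := ⟨rfl⟩

/-- The composition operator `C_ψ : 𝒪_M(ℝ) → 𝒪_M(ℝ)`, `f ↦ f ∘ ψ`, for a real-valued symbol
`ψ ∈ 𝒪_M(ℝ)`. -/
def compOp (𝕜 : Type*) [RCLike 𝕜] (ψ : ℝ → ℝ) (hψ : ψ.HasTemperateGrowth) :
    OM 𝕜 →ₗ[𝕜] OM 𝕜 where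
  toFun f := ⟨(f : ℝ → 𝕜) ∘ ψ, f.hasTemperateGrowth.comp hψ⟩
  map_add' _ _ := rfl
  map_smul' _ _ := rfl

end OM

/-- A self-map `T` of a topological space is mixing if for all non-empty open sets `U`, `V` there is
`N` such that `Tⁿ(U)` meets `V` for every `n ≥ N`. -/
def IsMixing {X : Type*} [TopologicalSpace X] (T : X → X) : Prop :=
  ∀ U V : Set X, IsOpen U → U.Nonempty → IsOpen V → V.Nonempty →
    ∃ N : ℕ, ∀ n ≥ N, ((T^[n] '' U) ∩ V).Nonempty

/-- The iterate `ψ_n`, `n ∈ ℤ`, of a bijection `ψ : ℝ → ℝ`; for negative `n` it is the inverse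
function of `ψ_{-n}`. -/
def zIterate (ψ : ℝ → ℝ) (hψ : Function.Bijective ψ) (n : ℤ) : ℝ → ℝ :=
  ((Equiv.ofBijective ψ hψ : Equiv.Perm ℝ) ^ n : Equiv.Perm ℝ)

end

/-! An Abel function `H` straightens `ψ` into the translation by 1. Given such an `H`, it is a
diffeomorphism of the line, and for compactly supported `f`, `g` the functions `f ∘ ψ_n` and `g ∘
ψ_{-n}` are fixed test functions evaluated at `H + n` and `H - n`. Their derivatives have polynomial
bounds uniform in `n`, and they eventually vanish on each bounded set, so they tend to 0
(`OM.tendsto_comp_add_zero`). By density of such `f`, `g`, the functions `f + g ∘ ψ_{-n}` show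
mixing. Polynomial growth of `H` makes `n` at most polynomial in `|ψ_{±n}(0)|`, whence the two
limits.

Conversely, mixing excludes fixed points and critical points, so `ψ` is an increasing diffeomorphism
that moves all points in one direction. Approximating the pairs (identity, 0) and (0, identity)
gives, for large `|n|` of either sign, some `u` close to the identity on `[-R, R]` with `u ∘ ψ_n`
small (`IsMixing.exists_near_id`). Solving the expansion of a derivative of `u ∘ ψ_n` for the top
derivative of `ψ_n` yields polynomial bounds, uniform in `n`, at the points sent to `[-R, R]`
(`exists_polynomial_bound_iterates`). Then `H` is a renormalised sum of `θ ∘ ψ_n` over all integers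
`n`, with `θ` a smooth step; at each point at most five summands have nonzero derivatives, so the
bounds pass to `H` (`exists_abel_of_lt`). -/

theorem contDiff_ofBijective_symm {f : ℝ → ℝ} (hf : ContDiff ℝ ∞ f) (hb : Function.Bijective f)
    (h0 : ∀ x, deriv f x ≠ 0) : ContDiff ℝ ∞ (Equiv.ofBijective f hb).symm := by
  have hopen : IsOpenMap f := isOpenMap_of_hasStrictDerivAt
    (fun x => hf.contDiffAt.hasStrictDerivAt (by simp)) h0
  let e : ℝ ≃ₜ ℝ := (Equiv.ofBijective f hb).toHomeomorphOfContinuousOpen hf.continuous hopen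
  exact e.contDiff_symm_deriv (f' := deriv f) h0
    (fun x => ((hf.differentiable (by simp)) x).hasDerivAt) hf

theorem HasCompactSupport.exists_bound_iteratedDeriv {F : Type*} [NormedAddCommGroup F]
    [NormedSpace ℝ F] {G : ℝ → F} (hG : HasCompactSupport G) (hs : ContDiff ℝ ∞ G) (N : ℕ) :
    ∃ C, 0 ≤ C ∧ ∀ i ≤ N, ∀ x, ‖iteratedDeriv i G x‖ ≤ C := by
  have h (i : ℕ) : ∃ C, ∀ x, ‖_root_.iteratedFDeriv ℝ i G x‖ ≤ C :=
    (hG.iteratedFDeriv i).exists_bound_of_continuous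
      (hs.continuous_iteratedFDeriv (mod_cast le_top))
  choose C hC using h
  have hC0 (i : ℕ) : 0 ≤ C i := (norm_nonneg _).trans (hC i 0)
  refine ⟨∑ i ∈ Finset.range (N + 1), C i, Finset.sum_nonneg fun i _ => hC0 i, fun i hi x => ?_⟩
  rw [← norm_iteratedFDeriv_eq_norm_iteratedDeriv]
  exact (hC i x).trans (Finset.single_le_sum (f := C) (fun i _ => hC0 i) (by simp; omega))

theorem Function.HasTemperateGrowth.exists_bound_iteratedDeriv {F : Type*} [NormedAddCommGroup F]
    [NormedSpace ℝ F] {f : ℝ → F} (hf : f.HasTemperateGrowth) (N : ℕ) :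
    ∃ (C : ℝ) (k : ℕ), 1 ≤ C ∧ ∀ i ≤ N, ∀ x, ‖iteratedDeriv i f x‖ ≤ C * (1 + |x|) ^ k := by
  obtain ⟨k, C, hC, h⟩ := hf.norm_iteratedFDeriv_le_uniform N
  refine ⟨C + 1, k, by linarith, fun i hi x => ?_⟩
  rw [← norm_iteratedFDeriv_eq_norm_iteratedDeriv]
  refine (h i hi x).trans ?_
  rw [Real.norm_eq_abs]
  gcongr
  linarith

/-- Faà di Bruno bound for iterated derivatives of a composition at a point. -/
theorem norm_iteratedDeriv_comp_le {F : Type*} [NormedAddCommGroup F] [NormedSpace ℝ F]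
    {g : ℝ → F} {f : ℝ → ℝ} (hg : ContDiff ℝ ∞ g) (hf : ContDiff ℝ ∞ f) (n : ℕ) (x : ℝ) {C D : ℝ}
    (hC : ∀ i ≤ n, ‖iteratedDeriv i g (f x)‖ ≤ C)
    (hD : ∀ i, 1 ≤ i → i ≤ n → |iteratedDeriv i f x| ≤ D ^ i) :
    ‖iteratedDeriv n (g ∘ f) x‖ ≤ n.factorial * C * D ^ n := by
  rw [← norm_iteratedFDeriv_eq_norm_iteratedDeriv]
  refine norm_iteratedFDeriv_comp_le hg hf (N := ∞) (mod_cast le_top) x ?_ ?_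
  · intro i hi
    rw [norm_iteratedFDeriv_eq_norm_iteratedDeriv]
    exact hC i hi
  · intro i h1 hi
    rw [norm_iteratedFDeriv_eq_norm_iteratedDeriv]
    exact hD i h1 hi

theorem SchwartzMap.exists_one_add_pow_mul_norm_le {𝕜 : Type*} [RCLike 𝕜] (v : 𝓢(ℝ, 𝕜)) (k : ℕ) :
    ∃ M, 0 ≤ M ∧ ∀ x, (1 + |x|) ^ k * ‖v x‖ ≤ M := by
  refine ⟨2 ^ k * (Finset.Iic (k, 0)).sup (fun m => SchwartzMap.seminorm 𝕜 m.1 m.2) v,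
    by positivity, fun x => ?_⟩
  simpa using SchwartzMap.one_add_le_sup_seminorm_apply (𝕜 := 𝕜) (m := (k, 0)) le_rfl le_rfl v x

theorem one_le_one_add_abs (x : ℝ) : 1 ≤ 1 + |x| := by linarith [abs_nonneg x]

/-! ### Convergence and density in `𝒪_M` -/

namespace OM

variable {𝕜 : Type*} [RCLike 𝕜]

theorem coe_sub (f g : OM 𝕜) : ((f - g : OM 𝕜) : ℝ → 𝕜) = (f : ℝ → 𝕜) - g := rfl

/-- The element of `𝒪_M` given by a function of temperate growth. -/
def mk (f : ℝ → 𝕜) (hf : f.HasTemperateGrowth) : OM 𝕜 := ⟨f, hf⟩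

@[simp] theorem coe_mk (f : ℝ → 𝕜) (hf : f.HasTemperateGrowth) : (mk f hf : ℝ → 𝕜) = f := rfl

theorem contDiff (f : OM 𝕜) : ContDiff ℝ ∞ f := f.hasTemperateGrowth.1

instance : IsTopologicalAddGroup (OM 𝕜) := (withSeminorms (𝕜 := 𝕜)).topologicalAddGroup

theorem derivSeminorm_apply (j : ℕ) (v : 𝓢(ℝ, 𝕜)) (f : OM 𝕜) :
    derivSeminorm j v f = ⨆ x : ℝ, ‖v x * iteratedDeriv j f x‖ := rfl

/-- A sequence in `𝒪_M` with polynomial bounds on each derivative that are uniform along the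
sequence and which eventually vanishes on each bounded set tends to zero. -/
theorem tendsto_zero (u : ℕ → OM 𝕜)
    (hb : ∀ j, ∃ (C : ℝ) (k : ℕ), ∀ n x, ‖iteratedDeriv j (u n) x‖ ≤ C * (1 + |x|) ^ k)
    (hz : ∀ R, ∀ᶠ n in atTop, ∀ x, |x| < R → u n x = 0) : Tendsto u atTop (𝓝 0) := by
  rw [(withSeminorms (𝕜 := 𝕜)).tendsto_nhds]
  rintro ⟨m, v⟩ ε hε
  have key : ∀ j ∈ Finset.range (m + 1), ∀ᶠ n in atTop, derivSeminorm j v (u n) < ε := by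
    intro j _
    obtain ⟨C, k, hC⟩ := hb j
    -- One power more than the growth of the derivatives leaves a factor `1 / (1 + |x|)`, small
    -- outside the radius chosen next.
    obtain ⟨M, hM0, hM⟩ := v.exists_one_add_pow_mul_norm_le (k + 1)
    filter_upwards [hz (2 * (M * |C|) / ε + 1)] with n hn
    refine lt_of_le_of_lt ?_ (half_lt_self hε)
    rw [derivSeminorm_apply]
    refine ciSup_le fun x => ?_
    rcases lt_or_ge |x| (2 * (M * |C|) / ε + 1) with hx | hx
    · have : (u n : ℝ → 𝕜) =ᶠ[𝓝 x] (fun _ => (0 : 𝕜)) := by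
        filter_upwards [(isOpen_lt continuous_abs continuous_const).mem_nhds hx] with y hy
        exact hn y hy
      rw [this.iteratedDeriv_eq j]
      simpa using (half_pos hε).le
    · have hx1 : 0 < 1 + |x| := by positivity
      have h1 : ‖iteratedDeriv j (u n) x‖ ≤ |C| * (1 + |x|) ^ k :=
        (hC n x).trans (by gcongr; exact le_abs_self C)
      rw [norm_mul]
      have h2 : ‖v x‖ * ‖iteratedDeriv j (u n) x‖ * (1 + |x|) ≤ M * |C| := by
        calc ‖v x‖ * ‖iteratedDeriv j (u n) x‖ * (1 + |x|)
            ≤ ‖v x‖ * (|C| * (1 + |x|) ^ k) * (1 + |x|) := by gcongr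
          _ = ((1 + |x|) ^ (k + 1) * ‖v x‖) * |C| := by ring
          _ ≤ M * |C| := by gcongr; exact hM x
      have h3 : M * |C| ≤ ε / 2 * (1 + |x|) := by
        have : 2 * (M * |C|) / ε ≤ 1 + |x| := by linarith
        rw [div_le_iff₀ hε] at this
        linarith
      exact le_of_mul_le_mul_right (h2.trans h3) hx1
  filter_upwards [(Filter.eventually_all_finset _).2 key] with n hn
  rw [sub_zero]
  exact Seminorm.finset_sup_apply_lt hε hn

/-- Compactly supported functions, precomposed with `H + s n` where `|s n| → ∞`, tend to zero. -/
theorem tendsto_comp_add_zero {G : ℝ → 𝕜} (hG : HasCompactSupport G) (hGs : ContDiff ℝ ∞ G)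
    {H : ℝ → ℝ} (hH : H.HasTemperateGrowth) {s : ℕ → ℝ} (hs : Tendsto (fun n => |s n|) atTop atTop)
    (u : ℕ → OM 𝕜) (hu : ∀ n x, u n x = G (s n + H x)) : Tendsto u atTop (𝓝 0) := by
  refine tendsto_zero u (fun j => ?_) (fun R => ?_)
  · obtain ⟨C, hC0, hC⟩ := hG.exists_bound_iteratedDeriv hGs j
    obtain ⟨D, k, hD1, hD⟩ := hH.exists_bound_iteratedDeriv j
    refine ⟨j.factorial * C * D ^ j, k * j, fun n x => ?_⟩
    have e : (u n : ℝ → 𝕜) = G ∘ (fun x => s n + H x) := funext (hu n)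
    rw [e]
    refine (norm_iteratedDeriv_comp_le hGs (contDiff_const.add hH.1) j x
      (fun i hi => hC i hi _) (D := D * (1 + |x|) ^ k) ?_).trans (le_of_eq (by ring))
    intro i h1 hi
    have h2 : iteratedDeriv i (fun x => s n + H x) = iteratedDeriv i H := by
      exact funext fun y => iteratedDeriv_const_add (show 0 < i by omega) (s n)
    rw [h2]
    -- The composition bound wants the `i`-th power of one constant; this costs nothing because that
    -- constant is at least 1.
    refine (hD i hi x).trans (le_self_pow₀ ?_ (by omega))
    have := one_le_one_add_abs x
    exact one_le_mul_of_one_le_of_one_le hD1 (one_le_pow₀ this)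
  · obtain ⟨A, hA⟩ := hG.isCompact.isBounded.exists_norm_le
    obtain ⟨B, hB⟩ := (isCompact_Icc (a := -R) (b := R)).exists_bound_of_continuousOn
      hH.1.continuous.continuousOn
    filter_upwards [hs.eventually_gt_atTop (A + B)] with n hn x hx
    rw [hu]
    refine image_eq_zero_of_notMem_tsupport fun hmem => ?_
    have h1 := hA _ hmem
    have h2 := hB x (abs_le.1 hx.le)
    rw [Real.norm_eq_abs] at h1 h2
    have h3 : |s n| ≤ |s n + H x| + |H x| := by
      simpa using abs_sub (s n + H x) (H x)
    linarith

/-- Compactly supported functions are dense in `𝒪_M`. -/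
theorem exists_hasCompactSupport_mem {U : Set (OM 𝕜)} (hU : IsOpen U) (hne : U.Nonempty) :
    ∃ f ∈ U, HasCompactSupport (f : ℝ → 𝕜) := by
  obtain ⟨f, hf⟩ := hne
  let χ : ContDiffBump (0 : ℝ) := ⟨1, 2, one_pos, one_lt_two⟩
  have hχs : ContDiff ℝ ∞ χ := χ.contDiff
  -- The cutoff `χ (c n * x)` is 1 for `|x| ≤ n + 1`, and `c n ≤ 1` keeps its derivatives bounded
  -- uniformly in `n`.
  let c : ℕ → ℝ := fun n => ((n : ℝ) + 1)⁻¹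
  have hc0 (n : ℕ) : 0 < c n := by positivity
  have hc1 (n : ℕ) : c n ≤ 1 := inv_le_one_of_one_le₀ (by simp)
  have hcs (n : ℕ) : HasCompactSupport (fun x => χ (c n * x)) :=
    χ.hasCompactSupport.comp_homeomorph (Homeomorph.mulLeft₀ (c n) (hc0 n).ne')
  have hsm (n : ℕ) : ContDiff ℝ ∞ (fun x => χ (c n * x)) :=
    hχs.comp (contDiff_const.mul contDiff_id)
  have hcs' (n : ℕ) : HasCompactSupport (fun x => χ (c n * x) • f x) := (hcs n).smul_right
  have hsm' (n : ℕ) : ContDiff ℝ ∞ (fun x => χ (c n * x) • f x) := (hsm n).smul f.contDiff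
  let g : ℕ → OM 𝕜 := fun n => mk _ ((hcs' n).hasTemperateGrowth (hsm' n))
  have hlim : Tendsto (fun n => g n - f) atTop (𝓝 0) := by
    refine tendsto_zero _ (fun j => ?_) (fun R => ?_)
    · obtain ⟨C, hC0, hC⟩ := χ.hasCompactSupport.exists_bound_iteratedDeriv hχs j
      obtain ⟨D, k, hD1, hD⟩ := f.hasTemperateGrowth.exists_bound_iteratedDeriv j
      refine ⟨(∑ i ∈ Finset.range (j + 1), (j.choose i : ℝ) * C * D) + D, k, fun n x => ?_⟩
      have hj : ((j : ℕ∞) : WithTop ℕ∞) ≤ ∞ := mod_cast le_top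
      rw [coe_sub, iteratedDeriv_sub ((g n).contDiffAt j x) (f.contDiffAt j x), add_mul]
      refine (norm_sub_le _ _).trans (add_le_add ?_ (hD j le_rfl x))
      rw [← norm_iteratedFDeriv_eq_norm_iteratedDeriv]
      refine (norm_iteratedFDeriv_smul_le (hsm n) f.contDiff x hj).trans ?_
      rw [Finset.sum_mul]
      refine Finset.sum_le_sum fun i hi => ?_
      have hi' : i ≤ j := by simpa [Nat.lt_succ_iff] using hi
      rw [norm_iteratedFDeriv_eq_norm_iteratedDeriv, norm_iteratedFDeriv_eq_norm_iteratedDeriv,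
        mul_assoc, mul_assoc, mul_assoc]
      have h1 : ‖iteratedDeriv i (fun x => χ (c n * x)) x‖ ≤ C := by
        rw [iteratedDeriv_comp_const_mul (hχs.of_le (mod_cast le_top)) (c n)]
        simp only [norm_mul, norm_pow]
        have : ‖c n‖ ^ i ≤ 1 := pow_le_one₀ (norm_nonneg _) (by
          rw [Real.norm_of_nonneg (hc0 n).le]; exact hc1 n)
        calc _ ≤ 1 * C := by gcongr; exact hC i hi' _
          _ = C := one_mul C
      gcongr
      exact hD (j - i) (by omega) x
    · obtain ⟨N, hN⟩ := exists_nat_ge R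
      filter_upwards [eventually_ge_atTop N] with n hn x hx
      have h1 : χ (c n * x) = 1 := by
        refine χ.one_of_mem_closedBall ?_
        rw [mem_closedBall_zero_iff, norm_mul, Real.norm_of_nonneg (hc0 n).le]
        change ((n : ℝ) + 1)⁻¹ * |x| ≤ 1
        rw [inv_mul_le_iff₀ (by positivity)]
        have : (N : ℝ) ≤ n := mod_cast hn
        linarith
      rw [coe_sub]
      simp [g, h1]
  have hlim' : Tendsto g atTop (𝓝 f) := by simpa using hlim.add_const f
  obtain ⟨n, hn⟩ := (hlim'.eventually (hU.mem_nhds hf)).exists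
  exact ⟨g n, hn, hcs' n⟩

theorem iterate_compOp_apply (ψ : ℝ → ℝ) (hψ : ψ.HasTemperateGrowth) (n : ℕ) (f : OM 𝕜) (x : ℝ) :
    ((compOp 𝕜 ψ hψ)^[n] f) x = f (ψ^[n] x) := by
  induction n generalizing f x with
  | zero => rfl
  | succ n ih =>
    rw [Function.iterate_succ_apply, Function.iterate_succ_apply', ih]
    rfl

end OM

theorem zIterate_natCast (ψ : ℝ → ℝ) (hψ : Function.Bijective ψ) (n : ℕ) :
    zIterate ψ hψ n = ψ^[n] := by
  unfold zIterate
  rw [zpow_natCast, Equiv.Perm.coe_pow]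
  rfl

theorem tendsto_abs_natCast_atTop : Tendsto (fun n : ℕ => |(n : ℝ)|) atTop atTop := by
  simpa using tendsto_natCast_atTop_atTop (R := ℝ)

/-! ### From an Abel function to mixing and the limits -/

section AbelFunction

variable {𝕜 : Type*} [RCLike 𝕜] {ψ : ℝ → ℝ} {hbij : Function.Bijective ψ} {H : ℝ → ℝ}

theorem abel_zIterate (habel : ∀ x, H (ψ x) = H x + 1) (n : ℤ) (x : ℝ) :
    H (zIterate ψ hbij n x) = H x + n := by
  let e : Equiv.Perm ℝ := Equiv.ofBijective ψ hbij
  have he (y : ℝ) : H (e y) = H y + 1 := habel y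
  change H ((e ^ n) x) = H x + n
  induction n using Int.induction_on with
  | zero => simp
  | succ n ih =>
    rw [add_comm (n : ℤ) 1, zpow_add, zpow_one, Equiv.Perm.mul_apply, he, ih]; push_cast; ring
  | pred n ih =>
    have h := he ((e ^ (-(n : ℤ) - 1)) x)
    rw [← Equiv.Perm.mul_apply, ← zpow_one_add] at h
    rw [show (1 : ℤ) + (-n - 1) = -n by ring, ih] at h
    push_cast at h ⊢
    linarith

theorem injective_of_deriv_ne_zero (hH : ContDiff ℝ ∞ H) (h0 : ∀ x, deriv H x ≠ 0) :
    Function.Injective H := by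
  have key : ∀ a b, a < b → H a ≠ H b := fun a b hab heq => by
    obtain ⟨c, -, hc⟩ := exists_deriv_eq_zero hab hH.continuous.continuousOn heq
    exact h0 c hc
  intro a b hab
  rcases lt_trichotomy a b with h | h | h
  · exact absurd hab (key a b h)
  · exact h
  · exact absurd hab.symm (key b a h)

/-- Along the orbit of 0 the values of `H` are `H 0 + n` for all integers `n`, hence unbounded in
both directions; the intermediate value theorem does the rest. -/
theorem abel_surjective (hbij : Function.Bijective ψ) (hH : Continuous H)
    (habel : ∀ x, H (ψ x) = H x + 1) : Function.Surjective H := by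
  intro y
  obtain ⟨n, hn⟩ := exists_int_gt (y - H 0)
  obtain ⟨m, hm⟩ := exists_int_lt (y - H 0)
  refine mem_range_of_exists_le_of_exists_ge hH
    ⟨zIterate ψ hbij m 0, ?_⟩ ⟨zIterate ψ hbij n 0, ?_⟩
  · rw [abel_zIterate habel]; linarith
  · rw [abel_zIterate habel]; linarith

theorem isMixing_of_abel (hψ : ψ.HasTemperateGrowth) (hbij : Function.Bijective ψ)
    (hH : H.HasTemperateGrowth) (h0 : ∀ x, deriv H x ≠ 0) (habel : ∀ x, H (ψ x) = H x + 1) :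
    IsMixing (OM.compOp 𝕜 ψ hψ) := by
  have hHb : Function.Bijective H :=
    ⟨injective_of_deriv_ne_zero hH.1 h0, abel_surjective hbij hH.1.continuous habel⟩
  have hsymm := contDiff_ofBijective_symm hH.1 hHb h0
  let e : ℝ ≃ₜ ℝ :=
    { Equiv.ofBijective H hHb with
      continuous_toFun := hH.1.continuous
      continuous_invFun := hsymm.continuous }
  have he (x : ℝ) : e.symm (H x) = x := e.symm_apply_apply x
  have hcs (f : OM 𝕜) (hf : HasCompactSupport f) : HasCompactSupport (f ∘ e.symm) :=
    hf.comp_homeomorph e.symm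
  have hsm (f : OM 𝕜) : ContDiff ℝ ∞ (f ∘ e.symm) := f.contDiff.comp hsymm
  have hiter (n : ℕ) (x : ℝ) : H (ψ^[n] x) = H x + n := by
    rw [← zIterate_natCast ψ hbij, abel_zIterate habel]; simp
  intro U V hU hUne hV hVne
  obtain ⟨f, hfU, hf⟩ := OM.exists_hasCompactSupport_mem hU hUne
  obtain ⟨g, hgV, hg⟩ := OM.exists_hasCompactSupport_mem hV hVne
  -- This is `g ∘ ψ_{-n}`, written through `H` so that temperate growth follows from that of `H`,
  -- with no information on the growth of the inverse of `ψ`.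
  let a : ℕ → OM 𝕜 := fun n => OM.mk (fun x => (g ∘ e.symm) (-(n : ℝ) + H x))
    (((hcs g hg).hasTemperateGrowth (hsm g)).comp ((Function.HasTemperateGrowth.const _).add hH))
  have ha : Tendsto a atTop (𝓝 0) :=
    OM.tendsto_comp_add_zero (hcs g hg) (hsm g) hH (s := fun n => -(n : ℝ))
      (by simpa using tendsto_abs_natCast_atTop) a (fun n x => rfl)
  let b : ℕ → OM 𝕜 := fun n => (OM.compOp 𝕜 ψ hψ)^[n] f
  have hb : Tendsto b atTop (𝓝 0) := by
    refine OM.tendsto_comp_add_zero (hcs f hf) (hsm f) hH (s := fun n => (n : ℝ))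
      tendsto_abs_natCast_atTop b (fun n x => ?_)
    simp only [b, OM.iterate_compOp_apply, Function.comp_apply]
    rw [add_comm, ← hiter, he]
  have ha' : Tendsto (fun n => f + a n) atTop (𝓝 f) := by simpa using ha.const_add f
  have hb' : Tendsto (fun n => b n + g) atTop (𝓝 g) := by simpa using hb.add_const g
  obtain ⟨N, hN⟩ := eventually_atTop.1
    ((ha'.eventually (hU.mem_nhds hfU)).and (hb'.eventually (hV.mem_nhds hgV)))
  refine ⟨N, fun n hn => ⟨b n + g, ⟨f + a n, (hN n hn).1, ?_⟩, (hN n hn).2⟩⟩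
  refine DFunLike.ext _ _ fun x => ?_
  rw [OM.iterate_compOp_apply, OM.coe_add, OM.coe_add]
  simp only [Pi.add_apply, b, a, OM.iterate_compOp_apply, OM.coe_mk, Function.comp_apply]
  rw [hiter, show -(n : ℝ) + (H x + n) = H x by ring, he]

/-- Since `H` grows polynomially, `n` is at most a power of `1 + |y n|`, and `v` decays faster than
any such power. The sign `s` serves forward and backward orbits alike. -/
theorem tendsto_schwartz_mul_of_abel (hH : H.HasTemperateGrowth) {y : ℕ → ℝ} {s : ℝ}
    (hs : |s| = 1) (hy : ∀ n : ℕ, H (y n) = H 0 + s * n) (v : 𝓢(ℝ, 𝕜)) :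
    Tendsto (fun n : ℕ => v (y n) * (n : 𝕜)) atTop (𝓝 0) := by
  obtain ⟨C, k, hC1, hC⟩ := hH.exists_bound_iteratedDeriv 0
  -- The exponent `2 * k` controls `n ^ 2`: one factor `n` is in the claim, the other gives the
  -- decay `1 / n`.
  obtain ⟨M, hM0, hM⟩ := v.exists_one_add_pow_mul_norm_le (2 * k)
  have hn (n : ℕ) : (n : ℝ) ≤ |H 0| + C * (1 + |y n|) ^ k := by
    have h1 : |H (y n)| ≤ C * (1 + |y n|) ^ k := by simpa using hC 0 le_rfl (y n)
    have h2 : |s * n| = n := by rw [abs_mul, hs, one_mul, Nat.abs_cast]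
    have h3 : s * n = H (y n) - H 0 := by rw [hy]; ring
    rw [← h2, h3]
    linarith [abs_sub (H (y n)) (H 0)]
  set A := |H 0| + C with hA
  have hA0 : 0 < A := by positivity
  have hn' (n : ℕ) : (n : ℝ) ≤ A * (1 + |y n|) ^ k := by
    have : |H 0| ≤ |H 0| * (1 + |y n|) ^ k :=
      le_mul_of_one_le_right (abs_nonneg _) (one_le_pow₀ (one_le_one_add_abs _))
    have := hn n
    rw [hA, add_mul]
    linarith
  have hlim : Tendsto (fun n : ℕ => A ^ 2 * M * (n : ℝ)⁻¹) atTop (𝓝 0) := by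
    simpa using (tendsto_inv_atTop_nhds_zero_nat (𝕜 := ℝ)).const_mul (A ^ 2 * M)
  refine squeeze_zero_norm' ?_ hlim
  filter_upwards [eventually_gt_atTop 0] with n hpos
  have hnpos : (0 : ℝ) < n := mod_cast hpos
  rw [← div_eq_mul_inv, le_div_iff₀ hnpos, norm_mul, RCLike.norm_natCast]
  calc ‖v (y n)‖ * n * n = ‖v (y n)‖ * (n : ℝ) ^ 2 := by ring
    _ ≤ ‖v (y n)‖ * (A * (1 + |y n|) ^ k) ^ 2 := by gcongr; exact hn' n
    _ = A ^ 2 * ((1 + |y n|) ^ (2 * k) * ‖v (y n)‖) := by ring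
    _ ≤ A ^ 2 * M := by gcongr; exact hM _

end AbelFunction

/-! ### Polynomial bounds from Schwartz weights -/

/-- For every sequence of points there is a Schwartz function which decreases at these points
not faster than a prescribed rapidly decreasing rate. -/
theorem exists_schwartzMap_ge (y : ℕ → ℝ) :
    ∃ v : 𝓢(ℝ, ℝ), ∀ k, (2 ^ k * (1 + |y k|) ^ k)⁻¹ ≤ v (y k) := by
  let χ : ContDiffBump (0 : ℝ) := ⟨1, 2, one_pos, one_lt_two⟩
  have hχs : ContDiff ℝ ∞ χ := χ.contDiff
  let b : 𝓢(ℝ, ℝ) := χ.hasCompactSupport.toSchwartzMap hχs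
  -- For every fixed `p`, `a k * (1 + |y k|) ^ p ≤ 2⁻ᵏ` once `k ≥ p`, so all Schwartz seminorms of
  -- the bumps are summable.
  let a : ℕ → ℝ := fun k => (2 ^ k * (1 + |y k|) ^ k)⁻¹
  have ha (k : ℕ) : 0 < a k := by positivity
  let f : ℕ → ℝ → ℝ := fun k z => a k * χ (z - y k)
  have hfs (k : ℕ) : ContDiff ℝ ∞ (f k) :=
    contDiff_const.mul (hχs.comp (contDiff_id.sub contDiff_const))
  have hfd (k l : ℕ) (z : ℝ) :
      ‖iteratedFDeriv ℝ l (f k) z‖ = a k * ‖iteratedFDeriv ℝ l χ (z - y k)‖ := by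
    rw [norm_iteratedFDeriv_eq_norm_iteratedDeriv, norm_iteratedFDeriv_eq_norm_iteratedDeriv,
      iteratedDeriv_const_mul_field, iteratedDeriv_comp_sub_const, norm_mul,
      Real.norm_of_nonneg (ha k).le]
  have bound (p l : ℕ) : ∃ w : ℕ → ℝ, Summable w ∧
      ∀ k z, ‖z‖ ^ p * ‖iteratedFDeriv ℝ l (f k) z‖ ≤ w k := by
    obtain ⟨M, hM⟩ : ∃ M, ∀ t, (1 + ‖t‖) ^ p * ‖iteratedFDeriv ℝ l χ t‖ ≤ M :=
      ⟨_, fun t => SchwartzMap.one_add_le_sup_seminorm_apply (𝕜 := ℝ) (m := (p, l))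
        le_rfl le_rfl b t⟩
    have hM0 : 0 ≤ M := le_trans (by positivity) (hM 0)
    refine ⟨fun k => M * (a k * (1 + |y k|) ^ p), ?_, fun k z => ?_⟩
    · refine Summable.mul_left M ?_
      refine Summable.of_norm_bounded_eventually_nat summable_geometric_two ?_
      filter_upwards [eventually_ge_atTop p] with k hk
      rw [Real.norm_of_nonneg (by positivity)]
      have h1 : (1 + |y k|) ^ p ≤ (1 + |y k|) ^ k := pow_le_pow_right₀ (one_le_one_add_abs _) hk
      have h2 : 0 < (1 + |y k|) ^ k := by positivity
      calc a k * (1 + |y k|) ^ p ≤ a k * (1 + |y k|) ^ k := by gcongr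
        _ = (1 / 2) ^ k := by simp only [a]; rw [one_div, inv_pow]; field_simp
    · have h1 : ‖z‖ ^ p ≤ (1 + ‖z - y k‖) ^ p * (1 + |y k|) ^ p := by
        rw [← mul_pow]
        gcongr
        have h3 : ‖z‖ ≤ ‖z - y k‖ + |y k| := by simpa using norm_add_le (z - y k) (y k)
        nlinarith [norm_nonneg (z - y k), abs_nonneg (y k)]
      rw [hfd]
      calc ‖z‖ ^ p * (a k * ‖iteratedFDeriv ℝ l χ (z - y k)‖)
          ≤ ((1 + ‖z - y k‖) ^ p * (1 + |y k|) ^ p) *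
            (a k * ‖iteratedFDeriv ℝ l χ (z - y k)‖) := by gcongr
        _ = ((1 + ‖z - y k‖) ^ p * ‖iteratedFDeriv ℝ l χ (z - y k)‖) *
            (a k * (1 + |y k|) ^ p) := by ring
        _ ≤ M * (a k * (1 + |y k|) ^ p) := by gcongr; exact hM _
  choose w hw hwb using bound
  have hv : ∀ k : ℕ, (k : ℕ∞) ≤ (⊤ : ℕ∞) → Summable (w 0 k) := fun k _ => hw 0 k
  have h'f : ∀ (k i : ℕ) (x : ℝ), (k : ℕ∞) ≤ (⊤ : ℕ∞) →
      ‖iteratedFDeriv ℝ k (f i) x‖ ≤ w 0 k i := fun k i x _ => by simpa using hwb 0 k i x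
  let v : 𝓢(ℝ, ℝ) :=
    { toFun := fun z => ∑' k, f k z
      smooth' := contDiff_tsum hfs hv h'f
      decay' := fun p l => by
        refine ⟨∑' k, w p l k, fun z => ?_⟩
        have hs : Summable fun k => ‖iteratedFDeriv ℝ l (f k) z‖ :=
          Summable.of_nonneg_of_le (fun k => norm_nonneg _) (fun k => h'f l k z le_top) (hw 0 l)
        rw [iteratedFDeriv_tsum_apply hfs hv h'f le_top]
        calc ‖z‖ ^ p * ‖∑' k, iteratedFDeriv ℝ l (f k) z‖
            ≤ ‖z‖ ^ p * ∑' k, ‖iteratedFDeriv ℝ l (f k) z‖ := by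
              gcongr; exact norm_tsum_le_tsum_norm hs
          _ = ∑' k, ‖z‖ ^ p * ‖iteratedFDeriv ℝ l (f k) z‖ := tsum_mul_left.symm
          _ ≤ ∑' k, w p l k :=
              (hs.mul_left _).tsum_le_tsum (fun k => hwb p l k z) (hw p l) }
  refine ⟨v, fun k => ?_⟩
  have hs : Summable fun i => f i (y k) :=
    Summable.of_norm (Summable.of_nonneg_of_le (fun i => norm_nonneg _)
      (fun i => by simpa using h'f 0 i (y k) le_top) (hw 0 0))
  have hpos (i : ℕ) : 0 ≤ f i (y k) := mul_nonneg (ha i).le χ.nonneg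
  have h1 : f k (y k) = a k := by
    have : χ (0 : ℝ) = 1 := χ.one_of_mem_closedBall (by simp [χ])
    simp [f, this]
  calc a k = f k (y k) := h1.symm
    _ ≤ ∑' i, f i (y k) := hs.le_tsum k fun i _ => hpos i

/-- Values whose products with every Schwartz function are bounded are polynomially bounded. -/
theorem exists_polynomial_bound_of_forall_schwartzMap {ι : Type*} (x F : ι → ℝ)
    (h : ∀ v : 𝓢(ℝ, ℝ), ∃ M, ∀ i, |v (x i)| * F i ≤ M) :
    ∃ (C : ℝ) (k : ℕ), ∀ i, F i ≤ C * (1 + |x i|) ^ k := by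
  by_contra! hcon
  -- The factor `2 ^ k` cancels the one in the lower bound for `v`, leaving a product of at least
  -- `k`.
  choose i hi using fun k : ℕ => hcon (k * 2 ^ k) k
  obtain ⟨v, hv⟩ := exists_schwartzMap_ge fun k => x (i k)
  obtain ⟨M, hM⟩ := h v
  obtain ⟨k, hk⟩ := exists_nat_gt M
  have h1 := hi k
  have h2 : (k : ℝ) ≤ |v (x (i k))| * F (i k) := by
    have h3 : 0 < 2 ^ k * (1 + |x (i k)|) ^ k := by positivity
    have h4 : 0 ≤ F (i k) := le_trans (by positivity) h1.le
    calc (k : ℝ) = (2 ^ k * (1 + |x (i k)|) ^ k)⁻¹ * (k * 2 ^ k * (1 + |x (i k)|) ^ k) := by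
          field_simp
      _ ≤ |v (x (i k))| * F (i k) := by
          gcongr
          exact (hv k).trans (le_abs_self _)
  linarith [hM (i k)]

/-! ### Derivatives of the iterates -/

/-- A bound for the top order derivative of `φ` in terms of that of `u ∘ φ` and lower order
derivatives, where `u` is locally close to the identity. -/
theorem abs_iteratedDeriv_succ_le {u φ : ℝ → ℝ} (hu : ContDiff ℝ ∞ u) (hφ : ContDiff ℝ ∞ φ)
    (x : ℝ) (j : ℕ) {D : ℝ} (h1 : 1 / 2 ≤ deriv u (φ x))
    (h2 : ∀ i, 1 ≤ i → i ≤ j + 1 → |iteratedDeriv i u (φ x)| ≤ 2)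
    (h3 : ∀ i, 1 ≤ i → i ≤ j → |iteratedDeriv i φ x| ≤ D ^ i) (hD : 0 ≤ D) :
    |iteratedDeriv (j + 1) φ x| ≤ 2 * |iteratedDeriv (j + 1) (u ∘ φ) x| +
      (4 * ∑ i ∈ Finset.range j, (j.choose (i + 1) * (i + 1).factorial : ℝ)) * D ^ (j + 1) := by
  have hu' : ContDiff ℝ ∞ (deriv u) := (contDiff_infty_iff_deriv.1 hu).2
  have hφ' : ContDiff ℝ ∞ (deriv φ) := (contDiff_infty_iff_deriv.1 hφ).2
  have hder : deriv (u ∘ φ) = (deriv u ∘ φ) * deriv φ := by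
    ext t
    exact deriv_comp t (hu.differentiable (by simp) _) (hφ.differentiable (by simp) _)
  have hle : ((j : ℕ∞) : WithTop ℕ∞) ≤ ∞ := mod_cast le_top
  -- Leibniz' rule for `(u' ∘ φ) * φ'`: the term where no derivative falls on `u' ∘ φ` carries the
  -- top derivative of `φ`, with coefficient at least `1 / 2`.
  have hsum : iteratedDeriv (j + 1) (u ∘ φ) x =
      ∑ i ∈ Finset.range j, (j.choose (i + 1) : ℝ) * iteratedDeriv (i + 1) (deriv u ∘ φ) x *
        iteratedDeriv (j - (i + 1)) (deriv φ) x + deriv u (φ x) * iteratedDeriv (j + 1) φ x := by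
    rw [iteratedDeriv_succ', hder, iteratedDeriv_mul ((hu'.comp hφ).of_le hle).contDiffAt
      (hφ'.of_le hle).contDiffAt, Finset.sum_range_succ']
    simp [iteratedDeriv_succ']
  have hterm : ∀ i ∈ Finset.range j, |(j.choose (i + 1) : ℝ) *
      iteratedDeriv (i + 1) (deriv u ∘ φ) x * iteratedDeriv (j - (i + 1)) (deriv φ) x| ≤
      2 * (j.choose (i + 1) * (i + 1).factorial : ℝ) * D ^ (j + 1) := by
    intro i hi
    have hi' : i < j := by simpa using hi
    have e1 : |iteratedDeriv (i + 1) (deriv u ∘ φ) x| ≤ (i + 1).factorial * 2 * D ^ (i + 1) := by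
      refine norm_iteratedDeriv_comp_le hu' hφ (i + 1) x (fun l hl => ?_)
        (fun l hl1 hl => h3 l hl1 (by omega))
      rw [← iteratedDeriv_succ']
      exact h2 (l + 1) (by omega) (by omega)
    have e2 : |iteratedDeriv (j - (i + 1)) (deriv φ) x| ≤ D ^ (j - i) := by
      rw [← iteratedDeriv_succ', show j - (i + 1) + 1 = j - i by omega]
      exact h3 _ (by omega) (by omega)
    rw [abs_mul, abs_mul, Nat.abs_cast]
    calc _ ≤ (j.choose (i + 1) : ℝ) * ((i + 1).factorial * 2 * D ^ (i + 1)) * D ^ (j - i) := by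
          gcongr
      _ = 2 * (j.choose (i + 1) * (i + 1).factorial : ℝ) * (D ^ (i + 1) * D ^ (j - i)) := by ring
      _ = _ := by rw [← pow_add, show i + 1 + (j - i) = j + 1 by omega]
  have hS := (Finset.abs_sum_le_sum_abs _ _).trans (Finset.sum_le_sum hterm)
  rw [← Finset.sum_mul, ← Finset.mul_sum] at hS
  have hmul : deriv u (φ x) * |iteratedDeriv (j + 1) φ x| =
      |deriv u (φ x) * iteratedDeriv (j + 1) φ x| := by
    rw [abs_mul, abs_of_nonneg (by linarith : 0 ≤ deriv u (φ x))]
  rw [← sub_eq_iff_eq_add'.2 hsum] at hmul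
  have h5 := abs_sub (iteratedDeriv (j + 1) (u ∘ φ) x) (∑ i ∈ Finset.range j,
    (j.choose (i + 1) : ℝ) * iteratedDeriv (i + 1) (deriv u ∘ φ) x *
        iteratedDeriv (j - (i + 1)) (deriv φ) x)
  have h6 : 1 / 2 * |iteratedDeriv (j + 1) φ x| ≤ deriv u (φ x) * |iteratedDeriv (j + 1) φ x| := by
    gcongr
  linarith

/-- If the iterates of a diffeomorphism `e` of the line, composed with functions which are close to
the identity on `[-R, R]`, are small with respect to the weights given by Schwartz functions, then
the derivatives of the iterates are polynomially bounded at the points that they map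
to `[-R, R]`, uniformly in the iterate. -/
theorem exists_polynomial_bound_iterates {e : Equiv.Perm ℝ} (hs : ∀ n : ℤ, ContDiff ℝ ∞ (e ^ n))
    {R : ℝ} (hE : ∀ (m : ℕ) (v : 𝓢(ℝ, ℝ)), ∃ N : ℕ, ∀ n : ℤ, N ≤ n.natAbs →
      ∃ u : ℝ → ℝ, ContDiff ℝ ∞ u ∧
        (∀ y, |y| ≤ R → 1 / 2 ≤ deriv u y ∧ ∀ i, 1 ≤ i → i ≤ m → |iteratedDeriv i u y| ≤ 2) ∧
        ∀ x, |v x * iteratedDeriv m (u ∘ (e ^ n)) x| ≤ 1) (j : ℕ) :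
    ∃ (C : ℝ) (k : ℕ), 1 ≤ C ∧ ∀ i, 1 ≤ i → i ≤ j → ∀ (n : ℤ) (x : ℝ), |(e ^ n) x| ≤ R →
      |iteratedDeriv i (e ^ n) x| ≤ C * (1 + |x|) ^ k := by
  induction j with
  | zero => exact ⟨1, 0, le_rfl, fun i h1 h2 => absurd h1 (by omega)⟩
  | succ j ih =>
    obtain ⟨C, k, hC1, hC⟩ := ih
    -- The iterate is part of the index, so the resulting bound is uniform in `n`.
    let ι := {p : ℤ × ℝ // |(e ^ p.1) p.2| ≤ R}
    obtain ⟨C', k', hC'⟩ := exists_polynomial_bound_of_forall_schwartzMap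
      (fun p : ι => p.1.2) (fun p : ι => |iteratedDeriv (j + 1) (e ^ p.1.1) p.1.2|) (by
        intro v
        obtain ⟨N, hN⟩ := hE (j + 1) v
        -- For the finitely many small `|n|`, compactness suffices: `x` runs over the image of `[-R,
        -- R]` under `e ^ (-n)`.
        have hfin (n : ℤ) : ∃ M, ∀ x, |(e ^ n) x| ≤ R →
            |v x| * |iteratedDeriv (j + 1) (e ^ n) x| ≤ M := by
          have hcont : Continuous fun y : ℝ => |v ((e ^ (-n)) y)| *
              |iteratedDeriv (j + 1) (e ^ n) ((e ^ (-n)) y)| :=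
            (v.continuous.comp (hs (-n)).continuous).abs.mul
              (((hs n).continuous_iteratedDeriv (j + 1) (mod_cast le_top)).comp
                (hs (-n)).continuous).abs
          obtain ⟨M, hM⟩ := (isCompact_Icc (a := -R) (b := R)).exists_bound_of_continuousOn
            hcont.continuousOn
          refine ⟨M, fun x hx => ?_⟩
          have h1 := hM ((e ^ n) x) (abs_le.1 hx)
          have h2 : (e ^ (-n)) ((e ^ n) x) = x := by
            rw [← Equiv.Perm.mul_apply, ← zpow_add]; simp
          rw [h2] at h1
          exact (le_abs_self _).trans h1
        choose M hM using hfin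
        obtain ⟨A, hA0, hA⟩ := v.exists_one_add_pow_mul_norm_le (k * (j + 1))
        set c : ℝ := 4 * ∑ i ∈ Finset.range j, (j.choose (i + 1) * (i + 1).factorial : ℝ) with hc
        have hc0 : 0 ≤ c := by positivity
        refine ⟨2 + c * C ^ (j + 1) * A + ∑ n ∈ Finset.Icc (-(N : ℤ)) N, |M n|, ?_⟩
        rintro ⟨⟨n, x⟩, hx⟩
        change |(e ^ n) x| ≤ R at hx
        change |v x| * |iteratedDeriv (j + 1) (e ^ n) x| ≤ _
        have hsum0 : 0 ≤ ∑ n ∈ Finset.Icc (-(N : ℤ)) N, |M n| :=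
          Finset.sum_nonneg fun _ _ => abs_nonneg _
        rcases le_or_gt N n.natAbs with hn | hn
        · obtain ⟨u, hu, hu1, hu2⟩ := hN n hn
          have h1 := abs_iteratedDeriv_succ_le hu (hs n) x j (D := C * (1 + |x|) ^ k)
            (hu1 _ hx).1 (hu1 _ hx).2 (fun i hi1 hij => (hC i hi1 hij n x hx).trans
              (le_self_pow₀ (one_le_mul_of_one_le_of_one_le hC1
                (one_le_pow₀ (one_le_one_add_abs x))) (by omega))) (by positivity)
          rw [← hc] at h1
          have h2 := hu2 x
          rw [abs_mul] at h2
          have h3 : |v x| * (c * (C * (1 + |x|) ^ k) ^ (j + 1)) ≤ c * C ^ (j + 1) * A := by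
            calc |v x| * (c * (C * (1 + |x|) ^ k) ^ (j + 1))
                = c * C ^ (j + 1) * ((1 + |x|) ^ (k * (j + 1)) * |v x|) := by
                  rw [mul_pow, ← pow_mul]; ring
              _ ≤ _ := by gcongr; exact hA x
          have h4 := mul_le_mul_of_nonneg_left h1 (abs_nonneg (v x))
          rw [mul_add] at h4
          linarith
        · have h1 := (hM n x hx).trans (le_abs_self _)
          have h2 : |M n| ≤ ∑ n ∈ Finset.Icc (-(N : ℤ)) N, |M n| :=
            Finset.single_le_sum (f := fun n => |M n|) (fun _ _ => abs_nonneg _)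
              (by rw [Finset.mem_Icc]; omega)
          have h3 : 0 ≤ c * C ^ (j + 1) * A := by positivity
          linarith)
    refine ⟨C + |C'|, k + k', by linarith [abs_nonneg C'], fun i h1 hi n x hx => ?_⟩
    have hx1 := one_le_one_add_abs x
    rcases Nat.lt_or_ge i (j + 1) with hij | hij
    · refine (hC i h1 (by omega) n x hx).trans ?_
      gcongr
      · linarith [abs_nonneg C']
      · omega
    · obtain rfl : i = j + 1 := by omega
      refine (hC' ⟨(n, x), hx⟩).trans ?_
      gcongr
      · linarith [le_abs_self C']
      · omega

/-! ### Construction of the Abel function -/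

/-- A smooth step function, constant outside `(0, c)` and with positive derivative there. -/
theorem exists_smooth_step {c : ℝ} (hc : 0 < c) :
    ∃ θ : ℝ → ℝ, ContDiff ℝ ∞ θ ∧ (∀ x ≤ 0, θ x = 0) ∧ (∀ x, c ≤ x → θ x = 1) ∧
      (∀ x, 0 ≤ deriv θ x) ∧ ∀ x, 0 < x → x < c → 0 < deriv θ x := by
  let χ : ContDiffBump (c / 2) := ⟨c / 4, c / 2, by positivity, by linarith⟩
  let b : ℝ → ℝ := χ.normed MeasureTheory.volume
  have hbs : ContDiff ℝ ∞ b := χ.contDiff_normed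
  have hsupp : Function.support b = Set.Ioo 0 c := by
    rw [χ.support_normed_eq, Real.ball_eq_Ioo]
    simp [χ]
  have hder (x : ℝ) : HasDerivAt (fun x => ∫ t in (0 : ℝ)..x, b t) (b x) x :=
    intervalIntegral.integral_hasDerivAt_right (hbs.continuous.intervalIntegrable _ _)
      (hbs.continuous.stronglyMeasurableAtFilter _ _) hbs.continuous.continuousAt
  have hder' : deriv (fun x => ∫ t in (0 : ℝ)..x, b t) = b := funext fun x => (hder x).deriv
  refine ⟨fun x => ∫ t in (0 : ℝ)..x, b t, ?_, fun x hx => ?_, fun x hx => ?_, fun x => ?_,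
    fun x h0 h1 => ?_⟩
  · exact contDiff_infty_iff_deriv.2 ⟨fun x => (hder x).differentiableAt, by rwa [hder']⟩
  · refine intervalIntegral.integral_zero_ae (Eventually.of_forall fun t ht => ?_)
    rw [Set.uIoc_of_ge hx] at ht
    by_contra hne
    have : t ∈ Set.Ioo 0 c := hsupp ▸ (show t ∈ Function.support b from hne)
    linarith [this.1, ht.2]
  · change ∫ t in (0 : ℝ)..x, b t = 1
    rw [intervalIntegral.integral_eq_integral_of_support_subset]
    · exact χ.integral_normed
    · rw [hsupp]
      exact fun t ht => ⟨ht.1, by linarith [ht.2]⟩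
  · rw [hder']; exact χ.nonneg_normed x
  · rw [hder']
    have : x ∈ Function.support b := hsupp ▸ ⟨h0, h1⟩
    exact lt_of_le_of_ne (χ.nonneg_normed x) (Ne.symm this)

section IncreasingPerm

variable {e : Equiv.Perm ℝ}

theorem zpow_apply_zpow_neg_apply (n : ℤ) (x : ℝ) : (e ^ (-n)) ((e ^ n) x) = x := by
  rw [← Equiv.Perm.mul_apply, ← zpow_add]; simp

theorem strictMono_zpow (hmono : StrictMono e) (n : ℤ) : StrictMono (e ^ n : Equiv.Perm ℝ) := by
  have hnat (n : ℕ) : StrictMono (e ^ n : Equiv.Perm ℝ) := by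
    rw [Equiv.Perm.coe_pow]; exact hmono.iterate n
  obtain ⟨m, rfl | rfl⟩ := n.eq_nat_or_neg
  · simpa using hnat m
  · intro x y hxy
    rw [← (hnat m).lt_iff_lt, zpow_neg, zpow_natCast]
    simpa using hxy

theorem zpow_add_one_apply (n : ℤ) (x : ℝ) : (e ^ (n + 1)) x = e ((e ^ n) x) := by
  rw [add_comm, zpow_add, zpow_one, Equiv.Perm.mul_apply]

theorem zpow_apply_strictMono (hlt : ∀ x, x < e x) (x : ℝ) :
    StrictMono fun n : ℤ => (e ^ n) x :=
  strictMono_int_of_lt_succ fun n => by rw [zpow_add_one_apply]; exact hlt _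

/-- A bounded increasing orbit would converge to a fixed point. -/
theorem exists_le_pow_apply (hc : Continuous e) (hlt : ∀ x, x < e x) (x M : ℝ) :
    ∃ n : ℕ, M ≤ (e ^ (n : ℤ)) x := by
  by_contra! hcon
  have hmono : Monotone fun n : ℕ => (e ^ (n : ℤ)) x := fun a b hab =>
    (zpow_apply_strictMono hlt x).monotone (Int.ofNat_le.2 hab)
  have hbdd : BddAbove (Set.range fun n : ℕ => (e ^ (n : ℤ)) x) :=
    ⟨M, by rintro _ ⟨n, rfl⟩; exact (hcon n).le⟩
  have h1 := tendsto_atTop_ciSup hmono hbdd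
  set L := ⨆ n : ℕ, (e ^ (n : ℤ)) x
  have h2 : Tendsto (fun n : ℕ => (e ^ ((n + 1 : ℕ) : ℤ)) x) atTop (𝓝 (e L)) := by
    have := (hc.tendsto L).comp h1
    refine this.congr fun n => ?_
    rw [Nat.cast_add, Nat.cast_one, zpow_add_one_apply]
    rfl
  exact (hlt L).ne (tendsto_nhds_unique ((tendsto_add_atTop_iff_nat 1).2 h1) h2)

theorem exists_pow_neg_apply_le (hc : Continuous e) (hmono : StrictMono e) (hlt : ∀ x, x < e x)
    (x M : ℝ) : ∃ n : ℕ, (e ^ (-(n : ℤ))) x ≤ M := by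
  obtain ⟨n, hn⟩ := exists_le_pow_apply hc hlt M x
  refine ⟨n, ?_⟩
  have := (strictMono_zpow hmono (-(n : ℤ))).monotone hn
  rwa [zpow_apply_zpow_neg_apply] at this

/-- `[p, e p)` is a fundamental domain: the least `n` with `p ≤ (e ^ n) x` works, and it exists
because orbits are unbounded on both sides. -/
theorem exists_zpow_apply_mem_Ico (hc : Continuous e) (hmono : StrictMono e) (hlt : ∀ x, x < e x)
    (x p : ℝ) : ∃ n : ℤ, p ≤ (e ^ n) x ∧ (e ^ n) x < e p := by
  obtain ⟨a, ha⟩ := exists_le_pow_apply hc hlt x p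
  obtain ⟨b, hb⟩ := exists_pow_neg_apply_le hc hmono hlt x (p - 1)
  obtain ⟨n, hn, hmin⟩ := Int.exists_least_of_bdd (P := fun n => p ≤ (e ^ n) x)
    ⟨-(b : ℤ), fun z hz => (zpow_apply_strictMono hlt x).le_iff_le.1
      (show (e ^ (-(b : ℤ))) x ≤ (e ^ z) x by linarith)⟩ ⟨a, ha⟩
  refine ⟨n, hn, ?_⟩
  have h1 : (e ^ (n - 1)) x < p := by
    by_contra! h
    have := hmin _ h
    omega
  have h2 := hmono h1
  rwa [← zpow_add_one_apply, sub_add_cancel] at h2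

theorem deriv_zpow_pos (hs : ∀ n : ℤ, ContDiff ℝ ∞ (e ^ n : Equiv.Perm ℝ)) (hmono : StrictMono e)
    (n : ℤ) (x : ℝ) : 0 < deriv (e ^ n : Equiv.Perm ℝ) x := by
  have hd (n : ℤ) : Differentiable ℝ (e ^ n : Equiv.Perm ℝ) := (hs n).differentiable (by simp)
  refine lt_of_le_of_ne ((strictMono_zpow hmono n).monotone.deriv_nonneg) fun h0 => ?_
  have h1 : deriv ((e ^ (-n) : Equiv.Perm ℝ) ∘ (e ^ n : Equiv.Perm ℝ)) x = 1 := by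
    have : ((e ^ (-n) : Equiv.Perm ℝ) ∘ (e ^ n : Equiv.Perm ℝ)) = id :=
      funext fun y => zpow_apply_zpow_neg_apply n y
    rw [this]; simp
  rw [deriv_comp x (hd _ _) (hd _ _), ← h0] at h1
  simp at h1

/-- A fixed point free increasing diffeomorphism of the line whose iterates have polynomially
bounded derivatives at the points that they map to a given bounded set has an Abel function
in `𝒪_M`. -/
theorem exists_abel_of_lt (hs : ∀ n : ℤ, ContDiff ℝ ∞ (e ^ n : Equiv.Perm ℝ))
    (hmono : StrictMono e) (hlt : ∀ x, x < e x)
    (hB : ∀ (R : ℝ) (j : ℕ), ∃ (C : ℝ) (k : ℕ), 1 ≤ C ∧ ∀ i, 1 ≤ i → i ≤ j → ∀ (n : ℤ) (x : ℝ),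
      |(e ^ n) x| ≤ R → |iteratedDeriv i (e ^ n : Equiv.Perm ℝ) x| ≤ C * (1 + |x|) ^ k) :
    ∃ H : ℝ → ℝ, H.HasTemperateGrowth ∧ (∀ x, deriv H x ≠ 0) ∧ ∀ x, H (e x) = H x + 1 := by
  have hc : Continuous e := by simpa using (hs 1).continuous
  -- Two fundamental domains are used because `θ'` may vanish at the endpoints: `[e 0, e (e 0))`
  -- meets every orbit and lies in the open interval `(0, c)`.
  set c := e (e 0) with hcdef
  have hc0 : 0 < c := (hlt 0).trans (hlt _)
  obtain ⟨θ, hθs, hθ0, hθ1, hθd, hθpos⟩ := exists_smooth_step hc0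
  let g : ℤ → ℝ → ℝ := fun n => θ ∘ (e ^ n : Equiv.Perm ℝ)
  have hgs (n : ℤ) : ContDiff ℝ ∞ (g n) := hθs.comp (hs n)
  have hord (x : ℝ) := zpow_apply_strictMono hlt x
  -- partial sums and the sets where they are stationary
  let S : ℕ → ℝ → ℝ := fun N x => ∑ i ∈ Finset.range (2 * N + 1), g ((i : ℤ) - N) x - N
  let W : ℕ → Set ℝ := fun N => {x | c < (e ^ (N : ℤ)) x ∧ (e ^ (-(N : ℤ))) x < 0}
  have hWo (N : ℕ) : IsOpen (W N) :=
    (isOpen_lt continuous_const (hs _).continuous).inter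
      (isOpen_lt (hs _).continuous continuous_const)
  have hWmono : Monotone W := fun N M hNM x hx =>
    ⟨hx.1.trans_le ((hord x).monotone (Int.ofNat_le.2 hNM)),
      lt_of_le_of_lt ((hord x).monotone (by simpa using hNM)) hx.2⟩
  have hWex (x : ℝ) : ∃ N, x ∈ W N := by
    obtain ⟨a, ha⟩ := exists_le_pow_apply hc hlt x (c + 1)
    obtain ⟨b, hb⟩ := exists_pow_neg_apply_le hc hmono hlt x (-1)
    refine ⟨max a b, ?_, ?_⟩
    · have : (e ^ (a : ℤ)) x ≤ (e ^ ((max a b : ℕ) : ℤ)) x :=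
        (hord x).monotone (Int.ofNat_le.2 (le_max_left _ _))
      linarith
    · have : (e ^ (-((max a b : ℕ) : ℤ))) x ≤ (e ^ (-(b : ℤ))) x :=
        (hord x).monotone (neg_le_neg (Int.ofNat_le.2 (le_max_right _ _)))
      linarith
  have hSsucc (N : ℕ) (x : ℝ) (hx : x ∈ W N) : S (N + 1) x = S N x := by
    have hx' := hWmono (Nat.le_succ N) hx
    have h1 : g ((N + 1 : ℕ) : ℤ) x = 1 := hθ1 _ hx'.1.le
    have h2 : g (-((N + 1 : ℕ) : ℤ)) x = 0 := hθ0 _ hx'.2.le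
    simp only [S]
    rw [show 2 * (N + 1) + 1 = 2 * N + 1 + 1 + 1 by ring, Finset.sum_range_succ,
      Finset.sum_range_succ']
    rw [show ((2 * N + 1 + 1 : ℕ) : ℤ) - ((N + 1 : ℕ) : ℤ) = ((N + 1 : ℕ) : ℤ) by push_cast; ring,
      show ((0 : ℕ) : ℤ) - ((N + 1 : ℕ) : ℤ) = -((N + 1 : ℕ) : ℤ) by simp, h1, h2]
    have h3 : ∀ i ∈ Finset.range (2 * N + 1),
        g (((i + 1 : ℕ) : ℤ) - ((N + 1 : ℕ) : ℤ)) x = g ((i : ℤ) - N) x := fun i _ => by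
      congr 1; push_cast; ring
    rw [Finset.sum_congr rfl h3]
    push_cast
    ring
  have hSconst (N M : ℕ) (hNM : N ≤ M) (x : ℝ) (hx : x ∈ W N) : S M x = S N x := by
    induction M, hNM using Nat.le_induction with
    | base => rfl
    | succ M hM ih => rw [hSsucc M x (hWmono hM hx), ih]
  choose ν hν using hWex
  let H : ℝ → ℝ := fun x => S (ν x) x
  have hHS (N : ℕ) (x : ℝ) (hx : x ∈ W N) : H x = S N x := by
    rcases le_total N (ν x) with h | h
    · exact hSconst N _ h x hx
    · exact (hSconst _ N h x (hν x)).symm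
  have hHev (x : ℝ) : H =ᶠ[𝓝 x] S (ν x) := by
    filter_upwards [(hWo _).mem_nhds (hν x)] with y hy using hHS _ y hy
  have hSs (N : ℕ) : ContDiff ℝ ∞ (S N) :=
    (ContDiff.sum fun i _ => hgs _).sub contDiff_const
  have hHs : ContDiff ℝ ∞ H := contDiff_iff_contDiffAt.2 fun x =>
    (hSs (ν x)).contDiffAt.congr_of_eventuallyEq (hHev x)
  have hHd (j : ℕ) (hj : 1 ≤ j) (x : ℝ) : iteratedDeriv j H x =
      ∑ i ∈ Finset.range (2 * ν x + 1), iteratedDeriv j (g ((i : ℤ) - ν x)) x := by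
    have hle : ((j : ℕ∞) : WithTop ℕ∞) ≤ ∞ := mod_cast le_top
    have hcd (i : ℤ) : ContDiffAt ℝ j (g i) x := ((hgs i).of_le hle).contDiffAt
    rw [(hHev x).iteratedDeriv_eq j, ← iteratedDeriv_fun_sum fun i _ => hcd _]
    have h1 : S (ν x) = fun y =>
        (-(ν x : ℝ)) + ∑ i ∈ Finset.range (2 * ν x + 1), g ((i : ℤ) - ν x) y := by
      ext y; simp only [S]; ring
    rw [h1]
    exact iteratedDeriv_const_add (show 0 < j by omega) _
  -- derivatives of the summands
  have hgz (j : ℕ) (hj : 1 ≤ j) (n : ℤ) (x : ℝ) (hx : ¬ (0 ≤ (e ^ n) x ∧ (e ^ n) x ≤ c)) :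
      iteratedDeriv j (g n) x = 0 := by
    have hconst : ∃ a : ℝ, g n =ᶠ[𝓝 x] fun _ => a := by
      rcases lt_or_ge ((e ^ n) x) 0 with h | h
      · refine ⟨0, ?_⟩
        filter_upwards [(isOpen_lt (hs n).continuous continuous_const).mem_nhds h] with y hy
        exact hθ0 _ (le_of_lt hy)
      · have h' : c < (e ^ n) x := by
          by_contra! h'
          exact hx ⟨h, h'⟩
        refine ⟨1, ?_⟩
        filter_upwards [(isOpen_lt continuous_const (hs n).continuous).mem_nhds h'] with y hy
        exact hθ1 _ (le_of_lt hy)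
    obtain ⟨a, ha⟩ := hconst
    rw [ha.iteratedDeriv_eq j, iteratedDeriv_const, if_neg (by omega)]
  have hgb (j : ℕ) (hj : 1 ≤ j) : ∃ (C : ℝ) (k : ℕ), 0 ≤ C ∧ ∀ n x,
      |iteratedDeriv j (g n) x| ≤ C * (1 + |x|) ^ k := by
    obtain ⟨D, k, hD1, hD⟩ := hB c j
    have hθb (i : ℕ) : ∃ A, ∀ y ∈ Set.Icc 0 c, ‖iteratedDeriv i θ y‖ ≤ A :=
      isCompact_Icc.exists_bound_of_continuousOn
        (hθs.continuous_iteratedDeriv i (mod_cast le_top)).continuousOn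
    choose A hA using hθb
    have hA0 (i : ℕ) : 0 ≤ A i := (norm_nonneg _).trans (hA i 0 ⟨le_rfl, hc0.le⟩)
    have hsum0 : 0 ≤ ∑ i ∈ Finset.range (j + 1), A i := Finset.sum_nonneg fun i _ => hA0 i
    refine ⟨j.factorial * (∑ i ∈ Finset.range (j + 1), A i) * D ^ j, k * j, by positivity,
      fun n x => ?_⟩
    by_cases hx : 0 ≤ (e ^ n) x ∧ (e ^ n) x ≤ c
    · refine (norm_iteratedDeriv_comp_le hθs (hs n) j x (D := D * (1 + |x|) ^ k)
        (C := ∑ i ∈ Finset.range (j + 1), A i) (fun i hi => ?_) (fun i h1 hi => ?_)).trans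
        (le_of_eq (by ring))
      · exact (hA i _ hx).trans
          (Finset.single_le_sum (f := A) (fun i _ => hA0 i) (by simp; omega))
      · refine (hD i h1 hi n x (abs_le.2 ⟨by linarith, hx.2⟩)).trans (le_self_pow₀ ?_ (by omega))
        exact one_le_mul_of_one_le_of_one_le hD1 (one_le_pow₀ (one_le_one_add_abs x))
    · rw [hgz j hj n x hx, abs_zero]
      positivity
  have hHb (j : ℕ) (hj : 1 ≤ j) : ∃ (C : ℝ) (k : ℕ), 0 ≤ C ∧ ∀ x,
      |iteratedDeriv j H x| ≤ C * (1 + |x|) ^ k := by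
    obtain ⟨C, k, hC0, hC⟩ := hgb j hj
    refine ⟨5 * C, k, by positivity, fun x => ?_⟩
    rw [hHd j hj]
    classical
    let T := (Finset.range (2 * ν x + 1)).filter fun i : ℕ =>
      0 ≤ (e ^ ((i : ℤ) - ν x)) x ∧ (e ^ ((i : ℤ) - ν x)) x ≤ c
    have hT : ∑ i ∈ Finset.range (2 * ν x + 1), iteratedDeriv j (g ((i : ℤ) - ν x)) x =
        ∑ i ∈ T, iteratedDeriv j (g ((i : ℤ) - ν x)) x := by
      refine (Finset.sum_filter_of_ne fun i _ hne => ?_).symm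
      by_contra h
      exact hne (hgz j hj _ x h)
    -- Two steps of `e` carry `[0, ∞)` into `[c, ∞)`, so the active indices differ by at most 2;
    -- hence the count 5 below.
    have hclose (m n : ℤ) (hm : 0 ≤ (e ^ m) x) (hn : (e ^ n) x ≤ c) : n ≤ m + 2 := by
      refine (hord x).le_iff_le.1 (hn.trans ?_)
      have h2 : (e ^ (m + 2)) x = e (e ((e ^ m) x)) := by
        rw [show m + 2 = m + 1 + 1 by ring, zpow_add_one_apply, zpow_add_one_apply]
      change c ≤ (e ^ (m + 2)) x
      rw [h2, hcdef]
      exact hmono.monotone (hmono.monotone hm)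
    have hcard : (T.card : ℝ) ≤ 5 := by
      rcases T.eq_empty_or_nonempty with h | ⟨i₀, hi₀⟩
      · rw [h]; simp
      · have hsub : T ⊆ Finset.Icc (i₀ - 2) (i₀ + 2) := by
          intro i hi
          have p := (Finset.mem_filter.1 hi₀).2
          have q := (Finset.mem_filter.1 hi).2
          have h1 := hclose _ _ p.1 q.2
          have h2 := hclose _ _ q.1 p.2
          rw [Finset.mem_Icc]
          omega
        have := (Finset.card_le_card hsub).trans (by rw [Nat.card_Icc]; omega :
          (Finset.Icc (i₀ - 2) (i₀ + 2)).card ≤ 5)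
        exact_mod_cast this
    rw [hT]
    calc |∑ i ∈ T, iteratedDeriv j (g ((i : ℤ) - ν x)) x|
        ≤ ∑ i ∈ T, |iteratedDeriv j (g ((i : ℤ) - ν x)) x| := Finset.abs_sum_le_sum_abs _ _
      _ ≤ ∑ i ∈ T, C * (1 + |x|) ^ k := Finset.sum_le_sum fun i _ => hC _ x
      _ = T.card * (C * (1 + |x|) ^ k) := by rw [Finset.sum_const, nsmul_eq_mul]
      _ ≤ 5 * (C * (1 + |x|) ^ k) := by gcongr
      _ = 5 * C * (1 + |x|) ^ k := by ring
  refine ⟨H, ⟨hHs, fun j => ?_⟩, fun x => ?_, fun x => ?_⟩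
  · rcases Nat.eq_zero_or_pos j with rfl | hj
    · obtain ⟨C, k, hC0, hC⟩ := hHb 1 le_rfl
      refine ⟨k + 1, |H 0| + C, fun x => ?_⟩
      rw [norm_iteratedFDeriv_zero, Real.norm_eq_abs, Real.norm_eq_abs]
      -- The growth of `H` itself comes from that of `H'` by the mean value inequality, at the price
      -- of one more power.
      have h1 := (convex_Icc (-|x|) |x|).norm_image_sub_le_of_norm_deriv_le (f := H)
        (C := C * (1 + |x|) ^ k) (x := 0) (y := x)
        (fun y _ => hHs.differentiable (by simp) y) (fun y hy => by
          have := hC y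
          rw [iteratedDeriv_one] at this
          exact this.trans (mul_le_mul_of_nonneg_left
            (pow_le_pow_left₀ (by positivity) (by linarith [abs_le.2 hy]) k) hC0)) (by simp) ⟨neg_abs_le x, le_abs_self x⟩
      rw [sub_zero, Real.norm_eq_abs, Real.norm_eq_abs] at h1
      have h2 : |H x| ≤ |H x - H 0| + |H 0| := by simpa using abs_add_le (H x - H 0) (H 0)
      have h3 : |H 0| ≤ |H 0| * (1 + |x|) ^ (k + 1) :=
        le_mul_of_one_le_right (abs_nonneg _) (one_le_pow₀ (one_le_one_add_abs _))
      have h4 : C * (1 + |x|) ^ k * |x| ≤ C * (1 + |x|) ^ (k + 1) := by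
        rw [pow_succ, ← mul_assoc]
        gcongr
        linarith
      rw [add_mul]
      linarith
    · obtain ⟨C, k, hC0, hC⟩ := hHb j hj
      refine ⟨k, C, fun x => ?_⟩
      rw [norm_iteratedFDeriv_eq_norm_iteratedDeriv]
      exact hC x
  · have h1 := hHd 1 le_rfl x
    simp only [iteratedDeriv_one] at h1
    have hgd (n : ℤ) : deriv (g n) x =
        deriv θ ((e ^ n) x) * deriv (e ^ n : Equiv.Perm ℝ) x :=
      deriv_comp x (hθs.differentiable (by simp) _) ((hs n).differentiable (by simp) _)
    have hgd0 (n : ℤ) : 0 ≤ deriv (g n) x := by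
      rw [hgd]; exact mul_nonneg (hθd _) (deriv_zpow_pos hs hmono n x).le
    obtain ⟨n, hn1, hn2⟩ := exists_zpow_apply_mem_Ico hc hmono hlt x (e 0)
    have hpos : 0 < deriv (g n) x := by
      rw [hgd]
      exact mul_pos (hθpos _ ((hlt 0).trans_le hn1) hn2) (deriv_zpow_pos hs hmono n x)
    have hnlt : n < ν x := (hord x).lt_iff_lt.1 (hn2.trans (hν x).1)
    have hngt : -(ν x : ℤ) < n := (hord x).lt_iff_lt.1
      ((hν x).2.trans ((hlt 0).trans_le hn1))
    have hmem : (n + ν x).toNat ∈ Finset.range (2 * ν x + 1) := by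
      rw [Finset.mem_range]; omega
    have hle := Finset.single_le_sum (f := fun i : ℕ => deriv (g ((i : ℤ) - ν x)) x)
      (fun i _ => hgd0 _) hmem
    have hidx : (((n + ν x).toNat : ℕ) : ℤ) - ν x = n := by omega
    simp only [hidx] at hle
    rw [h1]
    exact (hpos.trans_le hle).ne'
  · let N := max (ν x) (ν (e x))
    have hx : x ∈ W N := hWmono (le_max_left _ _) (hν x)
    have hex : e x ∈ W N := hWmono (le_max_right _ _) (hν (e x))
    rw [hHS N x hx, hHS N (e x) hex]
    have hshift (n : ℤ) : g n (e x) = g (n + 1) x := by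
      simp only [g, Function.comp_apply]
      rw [zpow_add, zpow_one, Equiv.Perm.mul_apply]
    have h1 : g ((N : ℤ) + 1) x = 1 := by rw [← hshift]; exact hθ1 _ hex.1.le
    have h2 : g (-(N : ℤ)) x = 0 := hθ0 _ hx.2.le
    -- Passing from `x` to `e x` shifts the window of indices by one: a summand 0 leaves and a
    -- summand 1 enters.
    have h3 := Finset.sum_range_succ (fun i : ℕ => g ((i : ℤ) - N) x) (2 * N + 1)
    rw [Finset.sum_range_succ'] at h3
    rw [show ((2 * N + 1 : ℕ) : ℤ) - N = (N : ℤ) + 1 by push_cast; ring, h1,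
      show ((0 : ℕ) : ℤ) - N = -(N : ℤ) by simp, h2] at h3
    have h4 : ∑ i ∈ Finset.range (2 * N + 1), g ((i : ℤ) - N) (e x) =
        ∑ i ∈ Finset.range (2 * N + 1), g (((i + 1 : ℕ) : ℤ) - N) x :=
      Finset.sum_congr rfl fun i _ => by
        rw [hshift]; congr 1; push_cast; ring
    simp only [S]
    rw [h4]
    linarith

end IncreasingPerm

/-! ### Real parts and approximate identities -/

section RealPart

variable {𝕜 : Type*} [RCLike 𝕜]

theorem iteratedDeriv_re {f : ℝ → 𝕜} (hf : ContDiff ℝ ∞ f) (i : ℕ) (x : ℝ) :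
    iteratedDeriv i (fun y => RCLike.re (f y)) x = RCLike.re (iteratedDeriv i f x) := by
  have h := (RCLike.reCLM (K := 𝕜)).iteratedFDeriv_comp_left (i := i) (n := ∞) (x := x)
    hf.contDiffAt (mod_cast le_top)
  rw [iteratedDeriv_eq_iteratedFDeriv, iteratedDeriv_eq_iteratedFDeriv]
  exact congrArg (fun L => L fun _ => (1 : ℝ)) h

theorem contDiff_re {f : ℝ → 𝕜} (hf : ContDiff ℝ ∞ f) :
    ContDiff ℝ ∞ fun y => (RCLike.re (f y) : ℝ) :=
  (RCLike.reCLM (K := 𝕜)).contDiff.comp hf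

theorem exists_schwartzMap_eq_one (𝕜 : Type*) [RCLike 𝕜] (R : ℝ) :
    ∃ χ : 𝓢(ℝ, 𝕜), ∀ y, |y| ≤ R → χ y = 1 := by
  let b : ContDiffBump (0 : ℝ) := ⟨|R| + 1, |R| + 2, by positivity, by linarith⟩
  have hc : HasCompactSupport fun x => ((b x : ℝ) : 𝕜) :=
    b.hasCompactSupport.comp_left (g := fun r : ℝ => (r : 𝕜)) RCLike.ofReal_zero
  have hs : ContDiff ℝ ∞ fun x => ((b x : ℝ) : 𝕜) :=
    (RCLike.ofRealCLM (K := 𝕜)).contDiff.comp b.contDiff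
  refine ⟨hc.toSchwartzMap hs, fun y hy => ?_⟩
  have h1 : b y = 1 := b.one_of_mem_closedBall (by
    rw [mem_closedBall_zero_iff, Real.norm_eq_abs]
    change |y| ≤ |R| + 1
    linarith [le_abs_self R])
  change ((b y : ℝ) : 𝕜) = 1
  rw [h1, RCLike.ofReal_one]

end RealPart

namespace OM

variable {𝕜 : Type*} [RCLike 𝕜]

/-- The inclusion `ℝ → 𝕜`, as an element of `𝒪_M`. -/
def ofRealOM (𝕜 : Type*) [RCLike 𝕜] : OM 𝕜 :=
  mk (fun x : ℝ => (x : 𝕜)) (RCLike.ofRealCLM (K := 𝕜)).hasTemperateGrowth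

theorem iteratedDeriv_ofRealOM (i : ℕ) (hi : 1 ≤ i) (x : ℝ) :
    iteratedDeriv i (ofRealOM 𝕜) x = if i = 1 then 1 else 0 := by
  have h1 : deriv (ofRealOM 𝕜 : ℝ → 𝕜) = fun _ => 1 := by
    ext y
    change deriv (RCLike.ofRealCLM (K := 𝕜)) y = 1
    rw [((RCLike.ofRealCLM (K := 𝕜)).hasDerivAt (x := y)).deriv]
    simp
  obtain ⟨k, rfl⟩ : ∃ k, i = k + 1 := ⟨i - 1, by omega⟩
  rw [iteratedDeriv_succ', h1, iteratedDeriv_const]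
  simp

theorem norm_mul_iteratedDeriv_le {m j : ℕ} (hj : j ≤ m) (v : 𝓢(ℝ, 𝕜)) (f : OM 𝕜) (x : ℝ) :
    ‖v x * iteratedDeriv j f x‖ ≤ seminormFamily 𝕜 (m, v) f :=
  (le_ciSup (bddAbove j v f) x).trans
    (Seminorm.le_finset_sup_apply (p := fun j => derivSeminorm j v) (by simp; omega))

/-- The real part of a function close to the inclusion `ℝ → 𝕜` is close to the identity. -/
theorem re_near_id {g : OM 𝕜} {m : ℕ} {y : ℝ}
    (h : ∀ j ≤ m + 1, ‖iteratedDeriv j (g - ofRealOM 𝕜) y‖ < 1 / 2) :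
    1 / 2 ≤ deriv (fun x => (RCLike.re (g x) : ℝ)) y ∧
      ∀ i, 1 ≤ i → i ≤ m → |iteratedDeriv i (fun x => (RCLike.re (g x) : ℝ)) y| ≤ 2 := by
  have key (i : ℕ) (h1 : 1 ≤ i) (hi : i ≤ m + 1) :
      |iteratedDeriv i (fun x => (RCLike.re (g x) : ℝ)) y - if i = 1 then 1 else 0| < 1 / 2 := by
    have h2 := h i hi
    rw [coe_sub, iteratedDeriv_sub (g.contDiffAt i y) ((ofRealOM 𝕜).contDiffAt i y),
      iteratedDeriv_ofRealOM i h1] at h2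
    have h3 := (RCLike.abs_re_le_norm _).trans_lt h2
    rw [iteratedDeriv_re g.contDiff]
    split_ifs with hi1 <;> simpa [hi1] using h3
  constructor
  -- Order 1 is available even for `m = 0`, as the hypothesis reaches `m + 1`.
  · have := abs_lt.1 (key 1 le_rfl (by omega))
    rw [iteratedDeriv_one, if_pos rfl] at this
    linarith [this.1]
  · intro i h1 hi
    have := abs_lt.1 (key i h1 (by omega))
    rw [abs_le]
    split_ifs at this <;> constructor <;> linarith [this.1, this.2]

end OM

/-! ### Consequences of mixing -/

section Mixing

variable {𝕜 : Type*} [RCLike 𝕜] {ψ : ℝ → ℝ} {hψ : ψ.HasTemperateGrowth}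

theorem IsMixing.exists_approx (hmix : IsMixing (OM.compOp 𝕜 ψ hψ)) (a b : OM 𝕜) (m : ℕ)
    (v w : 𝓢(ℝ, 𝕜)) {ε : ℝ} (hε : 0 < ε) :
    ∃ N, ∀ n ≥ N, ∃ f : OM 𝕜,
      (∀ j ≤ m, ∀ x, ‖v x * iteratedDeriv j (f - a) x‖ < ε) ∧
      ∀ j ≤ m, ∀ x, ‖w x * iteratedDeriv j ((OM.compOp 𝕜 ψ hψ)^[n] f - b) x‖ < ε := by
  have hopen (a : OM 𝕜) (v : 𝓢(ℝ, 𝕜)) :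
      IsOpen {f : OM 𝕜 | OM.seminormFamily 𝕜 (m, v) (f - a) < ε} :=
    isOpen_lt ((OM.withSeminorms.continuous_seminorm (m, v)).comp
      (continuous_id.sub continuous_const)) continuous_const
  have hne (a : OM 𝕜) (v : 𝓢(ℝ, 𝕜)) :
      {f : OM 𝕜 | OM.seminormFamily 𝕜 (m, v) (f - a) < ε}.Nonempty := ⟨a, by simpa using hε⟩
  obtain ⟨N, hN⟩ := hmix _ _ (hopen a v) (hne a v) (hopen b w) (hne b w)
  refine ⟨N, fun n hn => ?_⟩
  obtain ⟨_, ⟨f, hf, rfl⟩, hg⟩ := hN n hn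
  exact ⟨f, fun j hj x => (OM.norm_mul_iteratedDeriv_le hj v _ x).trans_lt hf,
    fun j hj x => (OM.norm_mul_iteratedDeriv_le hj w _ x).trans_lt hg⟩

/-- At a fixed point `f` and all its images under powers of the operator take the same value, which
cannot be close to both 0 and 1. -/
theorem IsMixing.apply_ne_self (hmix : IsMixing (OM.compOp 𝕜 ψ hψ)) (x : ℝ) : ψ x ≠ x := by
  intro hx
  obtain ⟨χ, hχ⟩ := exists_schwartzMap_eq_one 𝕜 |x|
  obtain ⟨N, hN⟩ := hmix.exists_approx 0 (OM.mk (fun _ => 1) (.const 1)) 0 χ χ one_half_pos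
  obtain ⟨f, h1, h2⟩ := hN N le_rfl
  have h1 := h1 0 le_rfl x
  have h2 := h2 0 le_rfl x
  rw [iteratedDeriv_zero, hχ x le_rfl, one_mul] at h1 h2
  rw [sub_zero] at h1
  rw [OM.coe_sub, Pi.sub_apply, OM.iterate_compOp_apply, Function.iterate_fixed hx,
    OM.coe_mk] at h2
  have h3 := norm_sub_le (f x) (f x - 1)
  rw [sub_sub_cancel, norm_one] at h3
  linarith

/-- At a critical point of `ψ` every function in the range of the operator has derivative 0, so none
approximates the inclusion of `ℝ`. -/
theorem IsMixing.deriv_ne_zero (hmix : IsMixing (OM.compOp 𝕜 ψ hψ)) (x : ℝ) :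
    deriv ψ x ≠ 0 := by
  intro hx
  obtain ⟨χ, hχ⟩ := exists_schwartzMap_eq_one 𝕜 |x|
  obtain ⟨N, hN⟩ := hmix.exists_approx 0 (OM.ofRealOM 𝕜) 1 χ χ one_half_pos
  -- A positive exponent guarantees that the iterate lies in the range.
  obtain ⟨f, -, h2⟩ := hN (N + 1) (by omega)
  have h2 := h2 1 le_rfl x
  rw [hχ x le_rfl, one_mul, Function.iterate_succ_apply', OM.coe_sub,
    iteratedDeriv_sub (OM.contDiffAt _ 1 x) (OM.contDiffAt _ 1 x),
    OM.iteratedDeriv_ofRealOM 1 le_rfl, if_pos rfl, iteratedDeriv_one] at h2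
  have h3 (g : OM 𝕜) : deriv (OM.compOp 𝕜 ψ hψ g : ℝ → 𝕜) x = 0 := by
    change deriv ((g : ℝ → 𝕜) ∘ ψ) x = 0
    rw [deriv.scomp x (g.contDiff.differentiable (by simp) _) (hψ.1.differentiable (by simp) _),
      hx, zero_smul]
  rw [h3, zero_sub, norm_neg, norm_one] at h2
  norm_num at h2

/-- Mixing provides functions close to the identity near the origin whose compositions with the
iterates of the symbol are small. -/
theorem IsMixing.exists_near_id (hmix : IsMixing (OM.compOp 𝕜 ψ hψ))
    (hbij : Function.Bijective ψ) (R : ℝ) (m : ℕ) (v : 𝓢(ℝ, ℝ)) :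
    ∃ N : ℕ, ∀ n : ℤ, N ≤ n.natAbs → ∃ u : ℝ → ℝ, ContDiff ℝ ∞ u ∧
      (∀ y, |y| ≤ R → 1 / 2 ≤ deriv u y ∧ ∀ i, 1 ≤ i → i ≤ m → |iteratedDeriv i u y| ≤ 2) ∧
      ∀ x, |v x * iteratedDeriv m
        (u ∘ ((Equiv.ofBijective ψ hbij : Equiv.Perm ℝ) ^ n : Equiv.Perm ℝ)) x| ≤ 1 := by
  set e : Equiv.Perm ℝ := Equiv.ofBijective ψ hbij
  obtain ⟨χ, hχ⟩ := exists_schwartzMap_eq_one 𝕜 R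
  let w : 𝓢(ℝ, 𝕜) := SchwartzMap.postcompCLM (RCLike.ofRealCLM (K := 𝕜)) v
  have hw (x : ℝ) : ‖w x‖ = |v x| := by
    change ‖((v x : ℝ) : 𝕜)‖ = |v x|
    rw [RCLike.norm_ofReal]
  have hpow (n : ℕ) (x : ℝ) : (e ^ n) x = ψ^[n] x := by rw [Equiv.Perm.coe_pow]; rfl
  have hnear (g : OM 𝕜)
      (hg : ∀ j ≤ m + 1, ∀ x, ‖χ x * iteratedDeriv j (g - OM.ofRealOM 𝕜) x‖ < 1 / 2)
      (y : ℝ) (hy : |y| ≤ R) := OM.re_near_id (g := g) (m := m) (y := y) fun j hj => by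
    simpa [hχ y hy] using hg j hj y
  have hsmall (g : OM 𝕜)
      (hg : ∀ j ≤ m + 1, ∀ x, ‖w x * iteratedDeriv j (g - (0 : OM 𝕜)) x‖ < 1 / 2) (x : ℝ) :
      |v x * iteratedDeriv m (fun y => (RCLike.re (g y) : ℝ)) x| ≤ 1 := by
    have h1 := hg m (by omega) x
    rw [sub_zero, norm_mul, hw] at h1
    rw [iteratedDeriv_re g.contDiff, abs_mul]
    have h2 := mul_le_mul_of_nonneg_left
      (RCLike.abs_re_le_norm (iteratedDeriv m g x)) (abs_nonneg (v x))
    linarith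
  obtain ⟨N₁, hN₁⟩ := hmix.exists_approx (OM.ofRealOM 𝕜) 0 (m + 1) χ w one_half_pos
  obtain ⟨N₂, hN₂⟩ := hmix.exists_approx 0 (OM.ofRealOM 𝕜) (m + 1) w χ one_half_pos
  refine ⟨max N₁ N₂, fun n hn => ?_⟩
  obtain ⟨k, rfl | rfl⟩ := n.eq_nat_or_neg
  · obtain ⟨f, h1, h2⟩ := hN₁ k (by simpa using (le_max_left _ _).trans hn)
    refine ⟨fun y => RCLike.re (f y), contDiff_re f.contDiff, hnear f h1, fun x => ?_⟩
    convert hsmall _ h2 x using 4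
    ext y
    rw [OM.iterate_compOp_apply, Function.comp_apply, zpow_natCast, hpow]
  -- For negative exponents the roles swap: `u` is the real part of `f ∘ ψ_k`, close to the
  -- identity, and `u ∘ ψ_{-k}` is the real part of the small function `f`.
  · obtain ⟨f, h1, h2⟩ := hN₂ k (by simpa using (le_max_right _ _).trans hn)
    refine ⟨fun y => RCLike.re ((OM.compOp 𝕜 ψ hψ)^[k] f y), contDiff_re (OM.contDiff _),
      hnear _ h2, fun x => ?_⟩
    convert hsmall _ h1 x using 4
    ext y
    rw [Function.comp_apply, OM.iterate_compOp_apply, ← hpow, zpow_neg, zpow_natCast,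
      show (e ^ k) ((e ^ k)⁻¹ y) = y from (e ^ k).apply_symm_apply y]

theorem contDiff_zpow_ofBijective (hs : ContDiff ℝ ∞ ψ) (hbij : Function.Bijective ψ)
    (h0 : ∀ x, deriv ψ x ≠ 0) (n : ℤ) :
    ContDiff ℝ ∞ ((Equiv.ofBijective ψ hbij : Equiv.Perm ℝ) ^ n : Equiv.Perm ℝ) := by
  set e : Equiv.Perm ℝ := Equiv.ofBijective ψ hbij
  have he : ContDiff ℝ ∞ e := hs
  have he' : ContDiff ℝ ∞ (e⁻¹ : Equiv.Perm ℝ) := contDiff_ofBijective_symm hs hbij h0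
  induction n using Int.induction_on with
  | zero => simpa using contDiff_id
  | succ n ih => rw [zpow_add_one]; exact ih.comp he
  | pred n ih => rw [zpow_sub_one]; exact ih.comp he'

theorem lt_or_gt_of_apply_ne_self (hc : Continuous ψ) (hne : ∀ x, ψ x ≠ x) :
    (∀ x, x < ψ x) ∨ ∀ x, ψ x < x := by
  by_contra! hcon
  obtain ⟨⟨a, ha⟩, b, hb⟩ := hcon
  obtain ⟨x, hx⟩ := mem_range_of_exists_le_of_exists_ge (c := 0) (hc.sub continuous_id)
    ⟨a, by simpa using ha⟩ ⟨b, by simpa using hb⟩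
  exact hne x (sub_eq_zero.1 hx)

/-- A decreasing map would reverse the direction of motion between 0 and `ψ 0`, but the direction is
the same everywhere. -/
theorem strictMono_of_apply_ne_self (hc : Continuous ψ) (hinj : Function.Injective ψ)
    (hne : ∀ x, ψ x ≠ x) : StrictMono ψ := by
  refine (hc.strictMono_of_inj hinj).resolve_right fun hanti => ?_
  rcases lt_or_gt_of_apply_ne_self hc hne with h | h
  · exact (h (ψ 0)).not_gt (hanti (h 0))
  · exact (h (ψ 0)).not_gt (hanti (h 0))

theorem IsMixing.exists_abel (hmix : IsMixing (OM.compOp 𝕜 ψ hψ))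
    (hbij : Function.Bijective ψ) :
    ∃ H : ℝ → ℝ, H.HasTemperateGrowth ∧ (∀ x, deriv H x ≠ 0) ∧ ∀ x, H (ψ x) = H x + 1 := by
  have hc : Continuous ψ := hψ.1.continuous
  have hmono := strictMono_of_apply_ne_self hc hbij.1 hmix.apply_ne_self
  have hs := contDiff_zpow_ofBijective hψ.1 hbij hmix.deriv_ne_zero
  set e : Equiv.Perm ℝ := Equiv.ofBijective ψ hbij
  have hmono' : StrictMono e := hmono
  have hB (R : ℝ) (j : ℕ) := exists_polynomial_bound_iterates hs
    (hmix.exists_near_id hbij R) j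
  rcases lt_or_gt_of_apply_ne_self hc hmix.apply_ne_self with hlt | hgt
  · exact exists_abel_of_lt hs hmono' hlt hB
  -- If points move to the left, the inverse moves them to the right, and the negative of its Abel
  -- function serves for `ψ`. The bounds on the iterates cover both signs of `n`, so they hold for
  -- the inverse too.
  · have hinv (n : ℤ) : (e⁻¹) ^ n = e ^ (-n) := inv_zpow' e n
    obtain ⟨H, hH, hH0, habel⟩ := exists_abel_of_lt (e := e⁻¹)
      (fun n => by rw [hinv]; exact hs _)
      (by simpa using strictMono_zpow hmono' (-1))
      (fun x => by
        have : e (e⁻¹ x) < e⁻¹ x := hgt _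
        rwa [show e (e⁻¹ x) = x from e.apply_symm_apply x] at this)
      (fun R j => by
        obtain ⟨C, k, hC, h⟩ := hB R j
        refine ⟨C, k, hC, fun i h1 hi n x hx => ?_⟩
        rw [hinv] at hx ⊢
        exact h i h1 hi (-n) x hx)
    refine ⟨fun x => -H x, hH.neg, fun x => ?_, fun x => ?_⟩
    · rw [deriv.fun_neg]
      exact neg_ne_zero.2 (hH0 x)
    · have h1 := habel (e x)
      rw [show e⁻¹ (e x) = x from e.symm_apply_apply x] at h1
      change H x = H (ψ x) + 1 at h1
      linarith

end Mixing

theorem theorem4p1 {𝕜 : Type*} [RCLike 𝕜] (ψ : ℝ → ℝ) (hψ : ψ.HasTemperateGrowth)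
    (hbij : Function.Bijective ψ) :
    (IsMixing (OM.compOp 𝕜 ψ hψ) ∧
      ∀ v : 𝓢(ℝ, 𝕜),
        Tendsto (fun n : ℕ => v (zIterate ψ hbij (n : ℤ) 0) * (n : 𝕜)) atTop (𝓝 0) ∧
        Tendsto (fun n : ℕ => v (zIterate ψ hbij (-(n : ℤ)) 0) * (n : 𝕜)) atTop (𝓝 0)) ↔
    ∃ H : ℝ → ℝ, H.HasTemperateGrowth ∧ (∀ x, deriv H x ≠ 0) ∧
      ∀ x, H (ψ x) = H x + 1 := by
  refine ⟨fun h => h.1.exists_abel hbij, ?_⟩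
  rintro ⟨H, hH, h0, habel⟩
  refine ⟨isMixing_of_abel hψ hbij hH h0 habel, fun v => ⟨?_, ?_⟩⟩
  · exact tendsto_schwartz_mul_of_abel hH (s := 1) (by simp)
      (fun n => by rw [abel_zIterate habel]; simp) v
  · exact tendsto_schwartz_mul_of_abel hH (s := -1) (by simp)
      (fun n => by rw [abel_zIterate habel]; simp) v
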